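/- Let $\Bbbk$ be an algebraically closed field of characteristic zero, let $\alpha\in\Bbbk^\times$, and let $a\in\Bbbk[z]$ be a polynomial of degree $2$. Let $R=\Bbbk[z][x,y;\sigma,a]$ be the corresponding classical generalized Weyl algebra, that is, the $\Bbbk$-algebra obtained by adjoining to $\Bbbk[z]$ two variables $x$ and $y$ subject to the relations $$xy=\sigma(a),\qquad yx=a,\qquad xd=\sigma(d)x,\qquad yd=\sigma^{-1}(d)y\qquad (d\in\Bbbk[z]),$$ where $\sigma$ is the $\Bbbk$-algebra automorphism of $\Bbbk[z]$ with $\sigma(z)=z-\alpha$. Equip $R$ with the standard filtration, in which $\deg x=\deg y=\deg_z(a)=2$ and $\deg z=2$: the $m$-th piece is spanned by the words in $x,y,z$ of total degree at most $m$, and $\deg r$ is the least $m$ such that $r$ lies in the $m$-th piece. Call a $\Bbbk$-algebra automorphism $\phi$ of $R$ filtered if $\deg\phi(r)=\deg r$ for all $r\in R$. Let $G$ and $H$ be finite cyclic groups of filtered automorphisms of $R$. If the fixed rings $R^G$ and $R^H$ are isomorphic as $\Bbbk$-algebras, then $G\cong H$. In particular, if $R^H\cong R$ as $\Bbbk$-algebras,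 then $H$ is trivial. -/

import Mathlib

open Polynomial

universe u

/-- The symbols adjoined in the presentation of a generalized Weyl algebra over `D`: one for each
coefficient `d : D`, and the two variables `x` and `y`. -/
inductive GWAGen (D : Type u) : Type u
  | coeff (d : D) : GWAGen D
  | x : GWAGen D
  | y : GWAGen D

/-- The defining relations of `D[x, y; σ, a]` as a `𝕜`-algebra, for a commutative `𝕜`-algebra `D`:
the first four say that `D` maps to it by a homomorphism of `𝕜`-algebras, the last four are
`x y = σ(a)`, `y x = a`, `x d = σ(d) x` and `y d = σ⁻¹(d) y` for all `d` in `D`. -/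
inductive GWARel {𝕜 D : Type u} [CommRing 𝕜] [CommRing D] [Algebra 𝕜 D]
    (σ : D ≃ₐ[𝕜] D) (a : D) :
    FreeAlgebra 𝕜 (GWAGen D) → FreeAlgebra 𝕜 (GWAGen D) → Prop
  | coeff_one : GWARel σ a (FreeAlgebra.ι 𝕜 (GWAGen.coeff 1)) 1
  | coeff_add (d e : D) : GWARel σ a (FreeAlgebra.ι 𝕜 (GWAGen.coeff (d + e)))
      (FreeAlgebra.ι 𝕜 (GWAGen.coeff d) + FreeAlgebra.ι 𝕜 (GWAGen.coeff e))
  | coeff_mul (d e : D) : GWARel σ a (FreeAlgebra.ι 𝕜 (GWAGen.coeff (d * e)))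
      (FreeAlgebra.ι 𝕜 (GWAGen.coeff d) * FreeAlgebra.ι 𝕜 (GWAGen.coeff e))
  | coeff_smul (c : 𝕜) (d : D) : GWARel σ a (FreeAlgebra.ι 𝕜 (GWAGen.coeff (c • d)))
      (c • FreeAlgebra.ι 𝕜 (GWAGen.coeff d))
  | x_mul_y : GWARel σ a (FreeAlgebra.ι 𝕜 GWAGen.x * FreeAlgebra.ι 𝕜 GWAGen.y)
      (FreeAlgebra.ι 𝕜 (GWAGen.coeff (σ a)))
  | y_mul_x : GWARel σ a (FreeAlgebra.ι 𝕜 GWAGen.y * FreeAlgebra.ι 𝕜 GWAGen.x)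
      (FreeAlgebra.ι 𝕜 (GWAGen.coeff a))
  | x_mul_coeff (d : D) :
      GWARel σ a (FreeAlgebra.ι 𝕜 GWAGen.x * FreeAlgebra.ι 𝕜 (GWAGen.coeff d))
        (FreeAlgebra.ι 𝕜 (GWAGen.coeff (σ d)) * FreeAlgebra.ι 𝕜 GWAGen.x)
  | y_mul_coeff (d : D) :
      GWARel σ a (FreeAlgebra.ι 𝕜 GWAGen.y * FreeAlgebra.ι 𝕜 (GWAGen.coeff d))
        (FreeAlgebra.ι 𝕜 (GWAGen.coeff (σ.symm d)) * FreeAlgebra.ι 𝕜 GWAGen.y)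

/-- The generalized Weyl algebra (of degree one) `D[x, y; σ, a]`. -/
abbrev GWA {𝕜 D : Type u} [CommRing 𝕜] [CommRing D] [Algebra 𝕜 D]
    (σ : D ≃ₐ[𝕜] D) (a : D) : Type u :=
  RingQuot (GWARel σ a)

/-- The classical generalized Weyl algebra `𝕜[z][x, y; σ, a]`, where `σ(z) = z - α`. It is
meant for `α ≠ 0`. -/
abbrev ClassicalGWA {𝕜 : Type u} [Field 𝕜] (α : 𝕜) (a : 𝕜[X]) : Type u :=
  GWA (algEquivAevalXAddC (-α)) a

namespace ClassicalGWA

variable {𝕜 : Type u} [Field 𝕜] (α : 𝕜) (a : 𝕜[X])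

/-- The generators `x`, `y`, `z` of a classical generalized Weyl algebra, as letters. -/
inductive Letter : Type
  | x : Letter
  | y : Letter
  | z : Letter

/-- The element of the algebra that a letter stands for. -/
noncomputable def letterVal : Letter → ClassicalGWA α a
  | Letter.x => RingQuot.mkAlgHom 𝕜 _ (FreeAlgebra.ι 𝕜 GWAGen.x)
  | Letter.y => RingQuot.mkAlgHom 𝕜 _ (FreeAlgebra.ι 𝕜 GWAGen.y)
  | Letter.z => RingQuot.mkAlgHom 𝕜 _ (FreeAlgebra.ι 𝕜 (GWAGen.coeff X))

/-- The degrees of the generators: `deg x = deg y = n` and `deg z = 2`, where `n = deg_z(a)`. -/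
noncomputable def letterDeg : Letter → ℕ
  | Letter.x => a.natDegree
  | Letter.y => a.natDegree
  | Letter.z => 2

/-- The `m`-th piece of the standard filtration: the `𝕜`-span of all words in `x`, `y`, `z` whose
total degree is at most `m`. -/
noncomputable def stdFiltration (m : ℕ) : Submodule 𝕜 (ClassicalGWA α a) :=
  Submodule.span 𝕜
    {r | ∃ w : List Letter, (w.map (letterDeg a)).sum ≤ m ∧ (w.map (letterVal α a)).prod = r}

/-- The degree of an element for the standard filtration: the least `m` such that the element lies
in the `m`-th piece. (The filtration is exhaustive; the degree of `0` is `0` here.) -/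
noncomputable def stdDegree (r : ClassicalGWA α a) : ℕ :=
  sInf {m | r ∈ stdFiltration α a m}

/-- The group of filtered automorphisms: the `𝕜`-algebra automorphisms `φ` such that
`deg (φ r) = deg r` for all `r`. -/
noncomputable def filteredAut : Subgroup (ClassicalGWA α a ≃ₐ[𝕜] ClassicalGWA α a) where
  carrier := {φ | ∀ r, stdDegree α a (φ r) = stdDegree α a r}
  one_mem' := fun _ => rfl
  mul_mem' := fun {φ ψ} hφ hψ r => (hφ (ψ r)).trans (hψ r)
  inv_mem' := fun {φ} hφ r => by
    have h := hφ (φ.symm r)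
    rw [AlgEquiv.apply_symm_apply] at h
    exact h.symm

end ClassicalGWA

/-- The fixed ring `R ^ G` of a group `G` of `𝕜`-algebra automorphisms of `R`. -/
abbrev fixedRing {𝕜 R : Type u} [Field 𝕜] [Ring R] [Algebra 𝕜 R] (G : Subgroup (R ≃ₐ[𝕜] R)) :
    Subalgebra 𝕜 R :=
  FixedPoints.subalgebra 𝕜 R G

/-! The invariant is the dimension of the trace space `A / [A, A]`. For the fixed ring of a finite
cyclic group of `m` filtered automorphisms it equals `2 * m - 1`, so the fixed ring determines `m`,
and `m` determines the cyclic group.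

Since `a` is quadratic, `x y - y x = a(z - α) - a(z)` is linear in `z`. After rescaling and a shift
of `z`, the generators become a standard basis `E, F, H` of `𝔰𝔩₂`, and `R` is presented by the `𝔰𝔩₂`
relations together with a fixed value of the Casimir element (`isCasimirTriple_sl`,
`exists_lift_sl`). So `SL₂` acts on `R` by conjugation. A filtered automorphism preserves the second
filtration piece, which is `𝕜 ⊕ 𝔰𝔩₂`, and the bracket relations force it to come from `SL₂`
(`exists_conj_eq`). If it has finite order, it is conjugate to a diagonal one, which fixes `z` and
scales `x` and `y` by `ω` and `ω⁻¹` (`exists_diag_of_isOfFinOrder`).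

For such an automorphism of order `m`, the fixed ring is spanned by the monomials of weight
divisible by `m`. Commutators with `z` kill every nonzero weight in the trace space. What remains is
`𝕜[z]` modulo the elements `(σᵐ - 1)(B g)`, where `B = yᵐ xᵐ` has degree `2 * m`. The map `g ↦ (σᵐ -
1)(B g)` raises degrees by exactly `2 * m - 1`, which is therefore the dimension of its cokernel
(`traceDim_of_fixed_diag`). -/

namespace GWA

/-! ### Generalized Weyl algebras: universal property and monomials -/

variable {𝕜 D : Type u} [CommRing 𝕜] [CommRing D] [Algebra 𝕜 D] (σ : D ≃ₐ[𝕜] D) (a : D)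

/-- The structure homomorphism from the coefficient ring. -/
noncomputable def coeff : D →ₐ[𝕜] GWA σ a :=
  AlgHom.ofLinearMap
    { toFun := fun d => RingQuot.mkAlgHom 𝕜 (GWARel σ a) (FreeAlgebra.ι 𝕜 (GWAGen.coeff d))
      map_add' := fun d e => by
        rw [RingQuot.mkAlgHom_rel 𝕜 (GWARel.coeff_add d e), map_add]
      map_smul' := fun c d => by
        rw [RingQuot.mkAlgHom_rel 𝕜 (GWARel.coeff_smul c d), map_smul, RingHom.id_apply] }
    (by
      change RingQuot.mkAlgHom 𝕜 (GWARel σ a) _ = _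
      rw [RingQuot.mkAlgHom_rel 𝕜 GWARel.coeff_one, map_one])
    (fun d e => by
      change RingQuot.mkAlgHom 𝕜 (GWARel σ a) _ = _ * _
      rw [RingQuot.mkAlgHom_rel 𝕜 (GWARel.coeff_mul d e), map_mul]
      rfl)

/-- The generator `x`. -/
noncomputable def x : GWA σ a := RingQuot.mkAlgHom 𝕜 (GWARel σ a) (FreeAlgebra.ι 𝕜 GWAGen.x)

/-- The generator `y`. -/
noncomputable def y : GWA σ a := RingQuot.mkAlgHom 𝕜 (GWARel σ a) (FreeAlgebra.ι 𝕜 GWAGen.y)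

lemma coeff_apply (d : D) :
    coeff σ a d = RingQuot.mkAlgHom 𝕜 (GWARel σ a) (FreeAlgebra.ι 𝕜 (GWAGen.coeff d)) := rfl

lemma x_mul_y : x σ a * y σ a = coeff σ a (σ a) := by
  rw [x, y, ← map_mul, RingQuot.mkAlgHom_rel 𝕜 GWARel.x_mul_y, coeff_apply]

lemma y_mul_x : y σ a * x σ a = coeff σ a a := by
  rw [x, y, ← map_mul, RingQuot.mkAlgHom_rel 𝕜 GWARel.y_mul_x, coeff_apply]

lemma x_mul_coeff (d : D) : x σ a * coeff σ a d = coeff σ a (σ d) * x σ a := by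
  rw [x, coeff_apply, ← map_mul, RingQuot.mkAlgHom_rel 𝕜 (GWARel.x_mul_coeff d), map_mul,
    coeff_apply]

lemma y_mul_coeff (d : D) : y σ a * coeff σ a d = coeff σ a (σ.symm d) * y σ a := by
  rw [y, coeff_apply, ← map_mul, RingQuot.mkAlgHom_rel 𝕜 (GWARel.y_mul_coeff d), map_mul,
    coeff_apply]

section lift

variable {σ a} {B : Type u} [Ring B] [Algebra 𝕜 B]

/-- The universal property of a generalized Weyl algebra. -/
noncomputable def lift (f : D →ₐ[𝕜] B) (X Y : B) (hXY : X * Y = f (σ a)) (hYX : Y * X = f a)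
    (hX : ∀ d, X * f d = f (σ d) * X) (hY : ∀ d, Y * f d = f (σ.symm d) * Y) : GWA σ a →ₐ[𝕜] B :=
  RingQuot.liftAlgHom 𝕜
    ⟨FreeAlgebra.lift 𝕜 (fun g : GWAGen D => match g with
      | GWAGen.coeff d => f d
      | GWAGen.x => X
      | GWAGen.y => Y), by
      intro _ _ h
      induction h <;> simp [hXY, hYX, hX, hY]⟩

variable (f : D →ₐ[𝕜] B) (X Y : B) (hXY : X * Y = f (σ a)) (hYX : Y * X = f a)
    (hX : ∀ d, X * f d = f (σ d) * X) (hY : ∀ d, Y * f d = f (σ.symm d) * Y)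

@[simp] lemma lift_coeff (d : D) : lift f X Y hXY hYX hX hY (coeff σ a d) = f d := by
  simp [lift, coeff_apply]

@[simp] lemma lift_x : lift f X Y hXY hYX hX hY (x σ a) = X := by simp [lift, x]

@[simp] lemma lift_y : lift f X Y hXY hYX hX hY (y σ a) = Y := by simp [lift, y]

theorem algHom_ext {φ ψ : GWA σ a →ₐ[𝕜] B} (hc : ∀ d, φ (coeff σ a d) = ψ (coeff σ a d))
    (hx : φ (x σ a) = ψ (x σ a)) (hy : φ (y σ a) = ψ (y σ a)) : φ = ψ := by
  apply RingQuot.ringQuot_ext'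
  ext g
  cases g with
  | coeff d => exact hc d
  | x => exact hx
  | y => exact hy

end lift

/-- A linear subspace that contains `1` and is stable under left multiplication by the generators
is everything. -/
theorem eq_top_of_mul_mem (N : Submodule 𝕜 (GWA σ a)) (h1 : 1 ∈ N)
    (hc : ∀ d, ∀ n ∈ N, coeff σ a d * n ∈ N) (hx : ∀ n ∈ N, x σ a * n ∈ N)
    (hy : ∀ n ∈ N, y σ a * n ∈ N) : N = ⊤ := by
  have key : ∀ w : FreeAlgebra 𝕜 (GWAGen D), ∀ n ∈ N,
      RingQuot.mkAlgHom 𝕜 (GWARel σ a) w * n ∈ N := by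
    intro w
    induction w using FreeAlgebra.induction with
    | grade0 c =>
      intro n hn
      rw [AlgHom.commutes, ← Algebra.smul_def]
      exact N.smul_mem c hn
    | grade1 g =>
      cases g with
      | coeff d => exact hc d
      | x => exact hx
      | y => exact hy
    | mul w w' h h' =>
      intro n hn
      rw [map_mul, mul_assoc]
      exact h _ (h' n hn)
    | add w w' h h' =>
      intro n hn
      rw [map_add, add_mul]
      exact N.add_mem (h n hn) (h' n hn)
  refine eq_top_iff.2 fun r _ => ?_
  obtain ⟨w, rfl⟩ := RingQuot.mkAlgHom_surjective 𝕜 (GWARel σ a) r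
  simpa using key w 1 h1

lemma x_pow_mul_coeff (n : ℕ) (d : D) :
    x σ a ^ n * coeff σ a d = coeff σ a ((σ ^ n) d) * x σ a ^ n := by
  induction n generalizing d with
  | zero => simp
  | succ n ih =>
    rw [pow_succ, mul_assoc, x_mul_coeff, ← mul_assoc, ih, mul_assoc, ← pow_succ, pow_succ σ,
      AlgEquiv.mul_apply]

lemma y_pow_mul_coeff (n : ℕ) (d : D) :
    y σ a ^ n * coeff σ a d = coeff σ a ((σ⁻¹ ^ n) d) * y σ a ^ n := by
  induction n generalizing d with
  | zero => simp
  | succ n ih =>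
    rw [pow_succ, mul_assoc, y_mul_coeff, ← mul_assoc, ih, mul_assoc, ← pow_succ, pow_succ σ⁻¹,
      AlgEquiv.mul_apply]
    rfl

/-- The product `a σ⁻¹(a) ⋯ σ⁻ⁿ⁺¹(a)`. -/
noncomputable def twistedPow (n : ℕ) : D := ∏ j ∈ Finset.range n, (σ⁻¹ ^ j) a

lemma y_pow_mul_x_pow (n : ℕ) : y σ a ^ n * x σ a ^ n = coeff σ a (twistedPow σ a n) := by
  induction n with
  | zero => simp [twistedPow]
  | succ n ih =>
    rw [pow_succ, pow_succ', mul_assoc, ← mul_assoc (y σ a) (x σ a), y_mul_x, ← mul_assoc,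
      y_pow_mul_coeff, mul_assoc, ih, ← map_mul, twistedPow, twistedPow, Finset.prod_range_succ,
      mul_comm]

lemma x_pow_mul_y_pow (n : ℕ) :
    x σ a ^ n * y σ a ^ n = coeff σ a ((σ ^ n) (twistedPow σ a n)) := by
  induction n with
  | zero => simp [twistedPow]
  | succ n ih =>
    rw [pow_succ', pow_succ (y σ a), mul_assoc, ← mul_assoc _ _ (y σ a), ih, ← mul_assoc,
      x_mul_coeff, mul_assoc, x_mul_y, ← map_mul, twistedPow, twistedPow, Finset.prod_range_succ,
      map_mul (σ ^ (n + 1)), ← AlgEquiv.mul_apply (σ ^ (n + 1)), pow_succ' σ,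
      AlgEquiv.mul_apply σ, mul_assoc σ (σ ^ n), inv_pow, mul_inv_cancel, mul_one]

/-- Groups the `m * i` factors into `i` blocks of length `m`, each a shift of the first. The
divisibility this gives is what `shift_pow_mul_sub_mem` needs. -/
lemma twistedPow_mul (m i : ℕ) :
    twistedPow σ a (m * i) = ∏ l ∈ Finset.range i, (σ⁻¹ ^ (m * l)) (twistedPow σ a m) := by
  induction i with
  | zero => simp [twistedPow]
  | succ i ih =>
    rw [Finset.prod_range_succ, ← ih, twistedPow, mul_add_one, Finset.prod_range_add, twistedPow,
      twistedPow, map_prod]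
    simp only [pow_add, AlgEquiv.mul_apply]

/-- The spanning set of monomials. -/
theorem span_monomials :
    Submodule.span 𝕜 ({r | ∃ d n, r = coeff σ a d * x σ a ^ n} ∪
      {r | ∃ d n, r = coeff σ a d * y σ a ^ n}) = ⊤ := by
  set S := {r | ∃ d n, r = coeff σ a d * x σ a ^ n} ∪ {r | ∃ d n, r = coeff σ a d * y σ a ^ n}
    with hS
  have hmul : ∀ u : GWA σ a, (∀ s ∈ S, u * s ∈ Submodule.span 𝕜 S) →
      ∀ n ∈ Submodule.span 𝕜 S, u * n ∈ Submodule.span 𝕜 S := fun u hu n hn => by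
    have : Submodule.span 𝕜 S ≤ (Submodule.span 𝕜 S).comap (LinearMap.mulLeft 𝕜 u) :=
      Submodule.span_le.2 hu
    exact this hn
  have memx : ∀ d n, coeff σ a d * x σ a ^ n ∈ Submodule.span 𝕜 S := fun d n =>
    Submodule.subset_span (Or.inl ⟨d, n, rfl⟩)
  have memy : ∀ d n, coeff σ a d * y σ a ^ n ∈ Submodule.span 𝕜 S := fun d n =>
    Submodule.subset_span (Or.inr ⟨d, n, rfl⟩)
  refine eq_top_of_mul_mem σ a _ (by simpa using memx 1 0) (fun d => hmul _ ?_) (hmul _ ?_)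
    (hmul _ ?_)
  · rintro _ (⟨e, n, rfl⟩ | ⟨e, n, rfl⟩)
    · rw [← mul_assoc, ← map_mul]; exact memx _ _
    · rw [← mul_assoc, ← map_mul]; exact memy _ _
  · rintro _ (⟨e, n, rfl⟩ | ⟨e, n, rfl⟩)
    · rw [← mul_assoc, x_mul_coeff, mul_assoc, ← pow_succ']; exact memx _ _
    · rcases n with _ | n
      · rw [pow_zero, mul_one, x_mul_coeff]; simpa using memx (σ e) 1
      · rw [← mul_assoc, x_mul_coeff, pow_succ', mul_assoc, ← mul_assoc (x σ a), x_mul_y,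
          ← mul_assoc, ← map_mul]
        exact memy _ _
  · rintro _ (⟨e, n, rfl⟩ | ⟨e, n, rfl⟩)
    · rcases n with _ | n
      · rw [pow_zero, mul_one, y_mul_coeff]; simpa using memy (σ.symm e) 1
      · rw [← mul_assoc, y_mul_coeff, pow_succ', mul_assoc, ← mul_assoc (y σ a), y_mul_x,
          ← mul_assoc, ← map_mul]
        exact memx _ _
    · rw [← mul_assoc, y_mul_coeff, mul_assoc, ← pow_succ']; exact memy _ _

/-! ### Weights and the component of degree zero -/

/-- The action of a generalized Weyl algebra on `D[t, t⁻¹; σ]`, completed: `x` acts as `t` and `y`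
as `a t⁻¹`. -/
noncomputable def laurentRep : GWA σ a →ₐ[𝕜] Module.End 𝕜 (ℤ → D) :=
  lift (Algebra.lsmul 𝕜 𝕜 (ℤ → D) |>.comp (Pi.constAlgHom 𝕜 ℤ D))
    { toFun := fun v i => σ (v (i - 1))
      map_add' := fun v w => by ext; simp
      map_smul' := fun c v => by ext; simp }
    { toFun := fun v i => a * σ.symm (v (i + 1))
      map_add' := fun v w => by ext; simp [mul_add]
      map_smul' := fun c v => by ext; simp }
    (by ext v i; simp)
    (by ext v i; simp)
    (fun d => by ext v i; simp)
    (fun d => by ext v i; simp [mul_left_comm])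

@[simp] lemma laurentRep_coeff (d : D) (v : ℤ → D) (i : ℤ) :
    laurentRep σ a (coeff σ a d) v i = d * v i := by simp [laurentRep]

@[simp] lemma laurentRep_x (v : ℤ → D) (i : ℤ) :
    laurentRep σ a (x σ a) v i = σ (v (i - 1)) := by simp [laurentRep]

@[simp] lemma laurentRep_y (v : ℤ → D) (i : ℤ) :
    laurentRep σ a (y σ a) v i = a * σ.symm (v (i + 1)) := by simp [laurentRep]

/-- The elements that act on Laurent series as homogeneous operators of degree `k`. -/
def weightSpace (k : ℤ) : Submodule 𝕜 (GWA σ a) where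
  carrier := {r | ∀ (v : ℤ → D) (i : ℤ), v (i - k) = 0 → laurentRep σ a r v i = 0}
  zero_mem' := fun v i _ => by simp
  add_mem' := fun hr hs v i h => by simp [hr v i h, hs v i h]
  smul_mem' := fun c r hr v i h => by simp [hr v i h]

variable {σ a} in
lemma mul_mem_weightSpace {r s : GWA σ a} {k l : ℤ} (hr : r ∈ weightSpace σ a k)
    (hs : s ∈ weightSpace σ a l) : r * s ∈ weightSpace σ a (k + l) := fun v i h => by
  rw [map_mul, Module.End.mul_apply]
  exact hr _ _ (hs _ _ (by rwa [sub_sub]))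

lemma coeff_mem_weightSpace (d : D) : coeff σ a d ∈ weightSpace σ a 0 := fun v i h => by
  rw [sub_zero] at h; simp [h]

lemma x_mem_weightSpace : x σ a ∈ weightSpace σ a 1 := fun v i h => by simp [h]

lemma y_mem_weightSpace : y σ a ∈ weightSpace σ a (-1) := fun v i h => by
  rw [sub_neg_eq_add] at h; simp [h]

lemma x_pow_mem_weightSpace (n : ℕ) : x σ a ^ n ∈ weightSpace σ a n := by
  induction n with
  | zero => simpa using coeff_mem_weightSpace σ a 1
  | succ n ih =>
    rw [pow_succ, Nat.cast_succ]
    exact mul_mem_weightSpace ih (x_mem_weightSpace σ a)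

lemma y_pow_mem_weightSpace (n : ℕ) : y σ a ^ n ∈ weightSpace σ a (-n) := by
  induction n with
  | zero => simpa using coeff_mem_weightSpace σ a 1
  | succ n ih =>
    rw [pow_succ, Nat.cast_succ, neg_add]
    exact mul_mem_weightSpace ih (y_mem_weightSpace σ a)

/-- The projection of a generalized Weyl algebra onto its component of degree zero. -/
noncomputable def degreeZero : GWA σ a →ₗ[𝕜] D :=
  LinearMap.proj (R := 𝕜) (φ := fun _ : ℤ => D) 0 ∘ₗ
    LinearMap.applyₗ (Pi.single 0 1 : ℤ → D) ∘ₗ (laurentRep σ a).toLinearMap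

lemma degreeZero_apply (r : GWA σ a) :
    degreeZero σ a r = laurentRep σ a r (Pi.single 0 1) 0 := rfl

@[simp] lemma degreeZero_coeff (d : D) : degreeZero σ a (coeff σ a d) = d := by
  simp [degreeZero_apply]

/-- An operator of weight `k` moves the vector supported at `0` to one supported at `k`. -/
lemma degreeZero_of_mem_weightSpace {r : GWA σ a} {k : ℤ} (hk : k ≠ 0)
    (hr : r ∈ weightSpace σ a k) : degreeZero σ a r = 0 :=
  hr _ _ (by simp [hk])

end GWA

/-! ### Casimir triples -/

/-- Triples of elements satisfying the relations of the standard basis of `𝔰𝔩₂` in which the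
Casimir element takes the value `κ`. -/
structure IsCasimirTriple {𝕜 B : Type*} [Field 𝕜] [Ring B] [Algebra 𝕜 B] (κ : 𝕜) (E F H : B) :
    Prop where
  lie_h_e : H * E = E * H + E
  lie_h_f : H * F = F * H - F
  lie_e_f : E * F = F * E + (2 : 𝕜) • H
  casimir : E * F + F * E + (2 : 𝕜) • (H * H) = algebraMap 𝕜 B κ

namespace IsCasimirTriple

variable {𝕜 B : Type*} [Field 𝕜] [Ring B] [Algebra 𝕜 B] {κ : 𝕜} {E F H : B}

/-- The effect of conjugation by a matrix of determinant one. -/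
theorem conj (h : IsCasimirTriple κ E F H) {p q r s : 𝕜} (hd : p * s - q * r = 1) :
    IsCasimirTriple κ (p ^ 2 • E - r ^ 2 • F - (2 * p * r) • H)
      (-(q ^ 2) • E + s ^ 2 • F + (2 * q * s) • H)
      (-(p * q) • E + (r * s) • F + (p * s + q * r) • H) := by
  obtain ⟨h1, h2, h3, h4⟩ := h
  -- Products are rewritten in a fixed order (`F` before `E` before `H`); each comparison of
  -- coefficients is then a polynomial identity modulo `p * s - q * r = 1`.
  constructor
  · simp only [mul_add, add_mul, mul_sub, sub_mul, smul_mul_assoc, mul_smul_comm, smul_add,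
      smul_sub, h1, h2, h3]
    match_scalars <;> grind
  · simp only [mul_add, add_mul, smul_mul_assoc, mul_smul_comm, smul_add,
      smul_sub, h1, h2, h3]
    match_scalars <;> grind
  · simp only [mul_add, add_mul, mul_sub, sub_mul, smul_mul_assoc, mul_smul_comm, smul_add,
      smul_sub, h1, h2, h3]
    match_scalars <;> grind
  · rw [← h4]
    simp only [mul_add, add_mul, mul_sub, sub_mul, smul_mul_assoc, mul_smul_comm, smul_add,
      smul_sub, h1, h2, h3]
    match_scalars <;> grind

end IsCasimirTriple

/-! ### The quadratic case as a quotient of the enveloping algebra of `𝔰𝔩₂` -/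

namespace ClassicalGWA

variable {𝕜 : Type u} [Field 𝕜] (α : 𝕜) (a : 𝕜[X])

/-- The generator `z`. -/
noncomputable abbrev z : ClassicalGWA α a := GWA.coeff (algEquivAevalXAddC (-α)) a X

lemma coeff_eq_aeval (d : 𝕜[X]) :
    GWA.coeff (algEquivAevalXAddC (-α)) a d = aeval (z α a) d := by
  rw [aeval_algHom_apply, aeval_X_left_apply]

lemma shift_pow_apply (n : ℕ) (d : 𝕜[X]) :
    (algEquivAevalXAddC (-α) ^ n) d = d.comp (X + C (-(n * α))) := by
  induction n generalizing d with
  | zero => simp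
  | succ n ih =>
    rw [pow_succ, AlgEquiv.mul_apply, ih, algEquivAevalXAddC_apply, ← comp_eq_aeval, comp_assoc]
    congr 1
    simp only [add_comp, X_comp, C_comp, add_assoc, ← C_add]
    congr 2
    push_cast
    ring

lemma shift_symm_apply (d : 𝕜[X]) :
    (algEquivAevalXAddC (-α)).symm d = aeval (X + C α) d := by
  rw [algEquivAevalXAddC_symm, algEquivAevalXAddC_apply, neg_neg]

lemma aeval_quadratic {B : Type*} [Ring B] [Algebra 𝕜 B] (ha : a.natDegree = 2) (Z : B) :
    aeval Z a = a.coeff 2 • (Z * Z) + a.coeff 1 • Z + algebraMap 𝕜 B (a.coeff 0) := by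
  rw [aeval_eq_sum_range, ha, Finset.sum_range_succ, Finset.sum_range_succ, Finset.sum_range_one,
    pow_zero, pow_one, sq, Algebra.algebraMap_eq_smul_one]
  abel

section lift

variable {α a} {B : Type u} [Ring B] [Algebra 𝕜 B]

/-- The universal property of a classical generalized Weyl algebra. -/
theorem exists_lift {X' Y' Z' : B} (hXZ : X' * Z' = Z' * X' - α • X')
    (hYZ : Y' * Z' = Z' * Y' + α • Y') (hXY : X' * Y' = aeval (Z' - algebraMap 𝕜 B α) a)
    (hYX : Y' * X' = aeval Z' a) :
    ∃ φ : ClassicalGWA α a →ₐ[𝕜] B, φ (GWA.x _ a) = X' ∧ φ (GWA.y _ a) = Y' ∧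
      φ (z α a) = Z' := by
  -- Commutation with `Z'` alone propagates to all polynomials in `Z'`; used with `c = -α` for `X'`
  -- and `c = α` for `Y'`.
  have comm : ∀ (c : 𝕜) (W : B), W * Z' = Z' * W + c • W → ∀ d : 𝕜[X],
      W * aeval Z' d = aeval Z' (aeval (X + C c) d) * W := fun c W hW d => by
    induction d using Polynomial.induction_on' with
    | add p q hp hq => simp only [map_add, mul_add, add_mul, hp, hq]
    | monomial n k =>
      rw [← C_mul_X_pow_eq_monomial]
      simp only [map_mul, map_pow, aeval_C, aeval_X, map_add]
      rw [← mul_assoc, ← Algebra.commutes, mul_assoc, algebraMap_eq, aeval_C, mul_assoc]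
      congr 1
      induction n with
      | zero => simp
      | succ n ih =>
        rw [pow_succ, ← mul_assoc, ih, mul_assoc, hW, pow_succ, mul_assoc, add_mul,
          Algebra.smul_def]
  refine ⟨GWA.lift (aeval Z') X' Y' ?_ hYX ?_ ?_, GWA.lift_x .., GWA.lift_y ..,
    (GWA.lift_coeff ..).trans (aeval_X _)⟩
  · rw [hXY, algEquivAevalXAddC_apply, ← aeval_algHom_apply]
    simp [sub_eq_add_neg]
  · exact fun d => comm (-α) X' (by rw [hXZ, neg_smul, sub_eq_add_neg]) d
  · intro d
    rw [shift_symm_apply]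
    exact comm α Y' hYZ d

theorem algHom_ext {φ ψ : ClassicalGWA α a →ₐ[𝕜] B} (hx : φ (GWA.x _ a) = ψ (GWA.x _ a))
    (hy : φ (GWA.y _ a) = ψ (GWA.y _ a)) (hz : φ (z α a) = ψ (z α a)) : φ = ψ :=
  GWA.algHom_ext (fun d => by rw [coeff_eq_aeval, ← aeval_algHom_apply, hz, aeval_algHom_apply])
    hx hy

end lift

lemma x_mul_z : GWA.x _ a * z α a = z α a * GWA.x _ a - α • GWA.x _ a := by
  rw [z, GWA.x_mul_coeff, algEquivAevalXAddC_apply, aeval_X, map_add, add_mul, ← algebraMap_eq,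
    AlgHom.commutes,
    ← Algebra.smul_def]
  module

lemma y_mul_z : GWA.y _ a * z α a = z α a * GWA.y _ a + α • GWA.y _ a := by
  rw [z, GWA.y_mul_coeff, shift_symm_apply, aeval_X, map_add, add_mul, ← algebraMap_eq,
    AlgHom.commutes, ← Algebra.smul_def α]

lemma y_mul_x : GWA.y _ a * GWA.x _ a = aeval (z α a) a := by
  rw [GWA.y_mul_x, coeff_eq_aeval]

lemma x_mul_y : GWA.x _ a * GWA.y _ a = aeval (z α a - algebraMap 𝕜 _ α) a := by
  rw [GWA.x_mul_y, algEquivAevalXAddC_apply, ← aeval_algHom_apply, map_add, ← algebraMap_eq,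
    AlgHom.commutes, map_neg, sub_eq_add_neg]

/-- The shift that makes `x y - y x` homogeneous in the new variable. -/
noncomputable def center : 𝕜 := a.coeff 1 / (2 * a.coeff 2) - α / 2

/-- The value of the Casimir element. -/
noncomputable def casimirValue : 𝕜 :=
  -(a.coeff 2 * α ^ 2 - a.coeff 1 * α + 2 * a.coeff 0 - 2 * a.coeff 2 * center α a ^ 2) /
    (α ^ 2 * a.coeff 2)

/-- The raising element of `𝔰𝔩₂`. -/
noncomputable def slE : ClassicalGWA α a := GWA.x _ a

/-- The lowering element of `𝔰𝔩₂`. -/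
noncomputable def slF : ClassicalGWA α a := (-(α ^ 2 * a.coeff 2)⁻¹) • GWA.y _ a

/-- The semisimple element of `𝔰𝔩₂`. -/
noncomputable def slH : ClassicalGWA α a := α⁻¹ • (z α a + algebraMap 𝕜 _ (center α a))

variable {α a}

lemma coeff_two_ne_zero (ha : a.natDegree = 2) : a.coeff 2 ≠ 0 := by
  rw [← ha, coeff_natDegree]; rintro h; simp [leadingCoeff_eq_zero.1 h] at ha

/-- Here `a(z - α) - a(z) = -2 a₂ α (z + center)` with `a₂ = a.coeff 2`, which explains the shift in
`slH` and the scalar in `slF`. The Casimir relation then records the constant term of `a` after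
completing the square. -/
theorem isCasimirTriple_sl [CharZero 𝕜] (hα : α ≠ 0) (ha : a.natDegree = 2) :
    IsCasimirTriple (casimirValue α a) (slE α a) (slF α a) (slH α a) := by
  have h2 := coeff_two_ne_zero ha
  have hyx := y_mul_x α a
  have hxy := x_mul_y α a
  have hxz := x_mul_z α a
  have hyz := y_mul_z α a
  rw [aeval_quadratic a ha] at hyx hxy
  constructor
  · simp only [slE, slH, Algebra.algebraMap_eq_smul_one, smul_mul_assoc, mul_smul_comm, mul_add,
      add_mul, hxz, mul_one, one_mul]
    match_scalars <;> field_simp <;> ring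
  · simp only [slF, slH, Algebra.algebraMap_eq_smul_one, smul_mul_assoc, mul_smul_comm, mul_add,
      add_mul, hyz, mul_one, one_mul]
    match_scalars <;> field_simp <;> ring
  · simp only [slE, slF, slH, Algebra.algebraMap_eq_smul_one, smul_mul_assoc, mul_smul_comm,
      mul_sub, sub_mul, hxy, hyx, mul_one, one_mul, center]
    match_scalars <;> field_simp <;> ring
  · simp only [slE, slF, slH, Algebra.algebraMap_eq_smul_one, smul_mul_assoc, mul_smul_comm,
      mul_add, add_mul, mul_sub, sub_mul, hxy, hyx, mul_one, one_mul, casimirValue, center]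
    match_scalars <;> field_simp <;> ring

section liftTriple

variable {B : Type u} [Ring B] [Algebra 𝕜 B]

theorem algHom_ext_sl (hα : α ≠ 0) (h2 : a.coeff 2 ≠ 0) {φ ψ : ClassicalGWA α a →ₐ[𝕜] B}
    (hE : φ (slE α a) = ψ (slE α a)) (hF : φ (slF α a) = ψ (slF α a))
    (hH : φ (slH α a) = ψ (slH α a)) : φ = ψ := by
  refine algHom_ext hE ?_ ?_
  · rw [slF, map_smul, map_smul] at hF
    exact smul_right_injective B (neg_ne_zero.2 (inv_ne_zero (mul_ne_zero (pow_ne_zero 2 hα) h2))) hF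
  · rw [slH, map_smul, map_smul] at hH
    have := smul_right_injective B (inv_ne_zero hα) hH
    simpa using this

/-- The converse of `isCasimirTriple_sl`: solving for `x, y, z` in terms of `E, F, H` turns the
Casimir relations back into the defining ones. -/
theorem exists_lift_sl [CharZero 𝕜] (hα : α ≠ 0) (ha : a.natDegree = 2) {E F H : B}
    (h : IsCasimirTriple (casimirValue α a) E F H) :
    ∃ φ : ClassicalGWA α a →ₐ[𝕜] B, φ (slE α a) = E ∧ φ (slF α a) = F ∧ φ (slH α a) = H := by
  have h2 := coeff_two_ne_zero ha
  obtain ⟨h1, h3, h4, h5⟩ := h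
  -- The Casimir relation solved for `H * H`, so as to eliminate the square coming from `a(z)`.
  have h5' : H * H = ((1 : 𝕜) / 2) • (casimirValue α a • 1 - (2 : 𝕜) • (F * E) - (2 : 𝕜) • H) := by
    rw [← Algebra.algebraMap_eq_smul_one, ← h5, h4]; match_scalars <;> norm_num
  obtain ⟨φ, hx, hy, hz⟩ := exists_lift (α := α) (a := a) (X' := E)
    (Y' := (-(α ^ 2 * a.coeff 2)) • F) (Z' := α • H - algebraMap 𝕜 B (center α a))
    (by
      simp only [Algebra.algebraMap_eq_smul_one, smul_mul_assoc, mul_smul_comm, mul_sub,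
        sub_mul, h1, mul_one, one_mul]
      module)
    (by
      simp only [Algebra.algebraMap_eq_smul_one, smul_mul_assoc, mul_smul_comm, mul_sub,
        sub_mul, h3, mul_one, one_mul]
      module)
    (by
      rw [aeval_quadratic a ha]
      simp only [Algebra.algebraMap_eq_smul_one, smul_mul_assoc, mul_smul_comm, mul_sub,
        sub_mul, h4, h5', mul_one, one_mul, casimirValue, center]
      match_scalars <;> field_simp <;> ring)
    (by
      rw [aeval_quadratic a ha]
      simp only [Algebra.algebraMap_eq_smul_one, smul_mul_assoc, mul_smul_comm, mul_sub,
        sub_mul, h5', mul_one, one_mul, casimirValue, center]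
      match_scalars <;> field_simp <;> ring)
  refine ⟨φ, hx, ?_, ?_⟩
  · rw [slF, map_smul, hy, smul_smul]
    match_scalars
    field_simp
  · rw [slH, map_smul, map_add, hz, AlgHom.commutes, sub_add_cancel, smul_smul,
      inv_mul_cancel₀ hα, one_smul]

end liftTriple

end ClassicalGWA

/-! ### The standard filtration and its second piece -/

namespace ClassicalGWA

open Matrix

variable {𝕜 : Type u} [Field 𝕜] {α : 𝕜} {a : 𝕜[X]}

/-- The elements `1`, `E`, `F`, `H` are linearly independent. -/
theorem sl_independent (hα : α ≠ 0) (h2 : a.coeff 2 ≠ 0) {c u v w : 𝕜}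
    (h : c • 1 + u • slE α a + v • slF α a + w • slH α a = 0) :
    c = 0 ∧ u = 0 ∧ v = 0 ∧ w = 0 := by
  have key : ∀ i : ℤ, GWA.laurentRep _ a
      (c • 1 + u • slE α a + v • slF α a + w • slH α a) (Pi.single 0 1) i = 0 := by
    rw [h]; simp
  have ha : a ≠ 0 := by rintro rfl; simp at h2
  -- On the vector supported at `0`, coordinate `1` detects `E`, coordinate `-1` detects `F`, and
  -- coordinate `0` is a polynomial of degree at most one that detects `H` and `1`.
  have k1 := key 1
  have k2 := key (-1)
  have k3 := key 0
  simp [slE, slF, slH] at k1 k2 k3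
  subst k1
  have hv : v = 0 := by simpa [hα, h2, ha] using k2
  subst hv
  have hw : w = 0 := by
    have := congrArg (fun p => coeff p 1) k3
    simpa [hα, coeff_one, coeff_C, Algebra.smul_def] using this
  subst hw
  have := congrArg (fun p => coeff p 0) k3
  simpa using this

theorem sl_ext (hα : α ≠ 0) (h2 : a.coeff 2 ≠ 0) {c u v w c' u' v' w' : 𝕜}
    (h : c • 1 + u • slE α a + v • slF α a + w • slH α a =
      c' • 1 + u' • slE α a + v' • slF α a + w' • slH α a) :
    c = c' ∧ u = u' ∧ v = v' ∧ w = w' := by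
  have := sl_independent (c := c - c') (u := u - u') (v := v - v') (w := w - w') hα h2
    (by rw [← sub_eq_zero] at h; rw [← h]; module)
  simpa [sub_eq_zero] using this

section filtration

lemma letterVal_x : letterVal α a Letter.x = GWA.x _ a := rfl
lemma letterVal_y : letterVal α a Letter.y = GWA.y _ a := rfl
lemma letterVal_z : letterVal α a Letter.z = z α a := rfl

lemma stdFiltration_mono {m n : ℕ} (h : m ≤ n) : stdFiltration α a m ≤ stdFiltration α a n :=
  Submodule.span_mono fun _ ⟨w, hw, hr⟩ => ⟨w, hw.trans h, hr⟩

lemma letterVal_mul_mem_stdFiltration (l : Letter) {m : ℕ} {r : ClassicalGWA α a}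
    (hr : r ∈ stdFiltration α a m) :
    letterVal α a l * r ∈ stdFiltration α a (letterDeg a l + m) := by
  have : stdFiltration α a m ≤ (stdFiltration α a (letterDeg a l + m)).comap
      (LinearMap.mulLeft 𝕜 (letterVal α a l)) := by
    refine Submodule.span_le.2 ?_
    rintro _ ⟨w, hw, rfl⟩
    exact Submodule.subset_span ⟨l :: w, by simpa using hw, by simp⟩
  exact this hr

/-- The standard filtration is exhaustive. -/
theorem exists_mem_stdFiltration (r : ClassicalGWA α a) : ∃ m, r ∈ stdFiltration α a m := by
  have hdir : Directed (· ≤ ·) (stdFiltration α a) :=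
    (monotone_nat_of_le_succ fun n => stdFiltration_mono n.le_succ).directed_le
  have hmul : ∀ l : Letter, ∀ n ∈ ⨆ m, stdFiltration α a m,
      letterVal α a l * n ∈ ⨆ m, stdFiltration α a m := fun l n hn => by
    obtain ⟨m, hm⟩ := (Submodule.mem_iSup_of_directed _ hdir).1 hn
    exact Submodule.mem_iSup_of_mem _ (letterVal_mul_mem_stdFiltration l hm)
  have htop : ⨆ m, stdFiltration α a m = ⊤ := by
    refine GWA.eq_top_of_mul_mem _ a _ ?_ (fun d n hn => ?_) (hmul Letter.x) (hmul Letter.y)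
    · exact Submodule.mem_iSup_of_mem 0 (Submodule.subset_span ⟨[], by simp, by simp⟩)
    · rw [coeff_eq_aeval]
      induction d using Polynomial.induction_on' with
      | add p q hp hq => rw [map_add, add_mul]; exact add_mem hp hq
      | monomial k c =>
        rw [← C_mul_X_pow_eq_monomial, map_mul, aeval_C, map_pow, aeval_X, mul_assoc,
          ← Algebra.smul_def]
        refine Submodule.smul_mem _ _ ?_
        induction k with
        | zero => simpa using hn
        | succ k ih => rw [pow_succ', mul_assoc]; exact hmul Letter.z _ ih
  have : r ∈ ⨆ m, stdFiltration α a m := htop ▸ Submodule.mem_top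
  exact (Submodule.mem_iSup_of_directed _ hdir).1 this

/-- Exhaustiveness makes the set under `sInf` nonempty, so the infimum is attained, and the
filtration is increasing. -/
lemma stdDegree_le_iff {r : ClassicalGWA α a} {m : ℕ} :
    stdDegree α a r ≤ m ↔ r ∈ stdFiltration α a m :=
  ⟨fun h => stdFiltration_mono h (Nat.sInf_mem (s := {m | r ∈ stdFiltration α a m})
    (exists_mem_stdFiltration r)), fun h => Nat.sInf_le h⟩

lemma letterVal_mem_stdFiltration (ha : a.natDegree = 2) (l : Letter) :
    letterVal α a l ∈ stdFiltration α a 2 :=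
  Submodule.subset_span ⟨[l], by cases l <;> simp [letterDeg, ha], by simp⟩

lemma one_mem_stdFiltration (m : ℕ) : (1 : ClassicalGWA α a) ∈ stdFiltration α a m :=
  Submodule.subset_span ⟨[], by simp, by simp⟩

lemma slE_mem_stdFiltration (ha : a.natDegree = 2) : slE α a ∈ stdFiltration α a 2 :=
  letterVal_mem_stdFiltration ha Letter.x

lemma slF_mem_stdFiltration (ha : a.natDegree = 2) : slF α a ∈ stdFiltration α a 2 :=
  Submodule.smul_mem _ _ (letterVal_mem_stdFiltration ha Letter.y)

lemma slH_mem_stdFiltration (ha : a.natDegree = 2) : slH α a ∈ stdFiltration α a 2 :=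
  Submodule.smul_mem _ _ (add_mem (letterVal_mem_stdFiltration ha Letter.z) (by
    rw [Algebra.algebraMap_eq_smul_one]
    exact Submodule.smul_mem _ _ (one_mem_stdFiltration 2)))

/-- As `deg a = 2`, all three letters have degree `2`, so a word of degree at most `2` has at most
one letter. -/
theorem exists_of_mem_stdFiltration (hα : α ≠ 0) (ha : a.natDegree = 2) {r : ClassicalGWA α a}
    (hr : r ∈ stdFiltration α a 2) :
    ∃ c u v w : 𝕜, r = c • 1 + u • slE α a + v • slF α a + w • slH α a := by
  have h2 := coeff_two_ne_zero ha
  induction hr using Submodule.span_induction with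
  | mem r hr =>
    obtain ⟨w, hw, rfl⟩ := hr
    match w with
    | [] => exact ⟨1, 0, 0, 0, by simp⟩
    | [Letter.x] => exact ⟨0, 1, 0, 0, by simp [letterVal_x, slE]⟩
    | [Letter.y] =>
      refine ⟨0, 0, -(α ^ 2 * a.coeff 2), 0, ?_⟩
      simp only [List.map_cons, List.map_nil, List.prod_singleton, letterVal_y, slF, zero_smul]
      match_scalars
      field_simp
    | [Letter.z] =>
      refine ⟨-center α a, 0, 0, α, ?_⟩
      simp only [List.map_cons, List.map_nil, List.prod_singleton, letterVal_z, slH, zero_smul,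
        Algebra.algebraMap_eq_smul_one]
      match_scalars <;> field_simp
      ring
    | l :: l' :: w =>
      exfalso
      have : ∀ l, letterDeg a l = 2 := by intro l; cases l <;> simp [letterDeg, ha]
      simp [this] at hw
  | zero => exact ⟨0, 0, 0, 0, by simp⟩
  | add r s _ _ hr hs =>
    obtain ⟨c, u, v, w, rfl⟩ := hr
    obtain ⟨c', u', v', w', rfl⟩ := hs
    exact ⟨c + c', u + u', v + v', w + w', by module⟩
  | smul k r _ hr =>
    obtain ⟨c, u, v, w, rfl⟩ := hr
    exact ⟨k * c, k * u, k * v, k * w, by module⟩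

theorem exists_coordinates (hα : α ≠ 0) (ha : a.natDegree = 2)
    {φ : ClassicalGWA α a ≃ₐ[𝕜] ClassicalGWA α a} (hφ : φ ∈ filteredAut α a)
    {r : ClassicalGWA α a} (hr : r ∈ stdFiltration α a 2) :
    ∃ c u v w : 𝕜, φ r = c • 1 + u • slE α a + v • slF α a + w • slH α a :=
  exists_of_mem_stdFiltration hα ha
    (stdDegree_le_iff.1 ((hφ r).le.trans (stdDegree_le_iff.2 hr)))

end filtration

/-! ### The action of `SL₂` -/

section conj

variable [CharZero 𝕜] (hα : α ≠ 0) (ha : a.natDegree = 2)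

omit [CharZero 𝕜] in
lemma det_eq (g : SpecialLinearGroup (Fin 2) 𝕜) : g 0 0 * g 1 1 - g 0 1 * g 1 0 = 1 := by
  have := g.det_coe
  rwa [Matrix.det_fin_two] at this

omit [CharZero 𝕜] in
lemma sl2_mul_apply (g h : SpecialLinearGroup (Fin 2) 𝕜) (i j : Fin 2) :
    (g * h) i j = g i 0 * h 0 j + g i 1 * h 1 j := by
  change (g.1 * h.1) i j = _
  rw [Matrix.mul_apply, Fin.sum_univ_two]

/-- The endomorphism of `R` induced by conjugation by `g` on `𝔰𝔩₂`. -/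
noncomputable def conjHom (g : SpecialLinearGroup (Fin 2) 𝕜) :
    ClassicalGWA α a →ₐ[𝕜] ClassicalGWA α a :=
  (exists_lift_sl hα ha ((isCasimirTriple_sl hα ha).conj (det_eq g))).choose

variable (g h : SpecialLinearGroup (Fin 2) 𝕜)

lemma conjHom_slE : conjHom hα ha g (slE α a) =
    g 0 0 ^ 2 • slE α a - g 1 0 ^ 2 • slF α a - (2 * g 0 0 * g 1 0) • slH α a :=
  (exists_lift_sl hα ha ((isCasimirTriple_sl hα ha).conj (det_eq g))).choose_spec.1

lemma conjHom_slF : conjHom hα ha g (slF α a) =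
    -(g 0 1 ^ 2) • slE α a + g 1 1 ^ 2 • slF α a + (2 * g 0 1 * g 1 1) • slH α a :=
  (exists_lift_sl hα ha ((isCasimirTriple_sl hα ha).conj (det_eq g))).choose_spec.2.1

lemma conjHom_slH : conjHom hα ha g (slH α a) =
    -(g 0 0 * g 0 1) • slE α a + (g 1 0 * g 1 1) • slF α a +
      (g 0 0 * g 1 1 + g 0 1 * g 1 0) • slH α a :=
  (exists_lift_sl hα ha ((isCasimirTriple_sl hα ha).conj (det_eq g))).choose_spec.2.2

lemma conjHom_one : conjHom hα ha 1 = AlgHom.id 𝕜 _ := by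
  refine algHom_ext_sl hα (coeff_two_ne_zero ha) ?_ ?_ ?_
  · simp [conjHom_slE]
  · simp [conjHom_slF]
  · simp [conjHom_slH]

/-- The formulas are those of the symmetric square of the standard representation (`E = e²`, `F =
-f²`, `H = -e f`), hence multiplicative identically in the matrix entries. -/
lemma conjHom_mul : conjHom hα ha (g * h) = (conjHom hα ha g).comp (conjHom hα ha h) := by
  refine algHom_ext_sl hα (coeff_two_ne_zero ha) ?_ ?_ ?_ <;>
  simp only [AlgHom.comp_apply, map_add, map_sub, map_smul, conjHom_slE, conjHom_slF,
    conjHom_slH, sl2_mul_apply] <;>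
  module

/-- The action of `SL₂` on `R`. -/
noncomputable def conj : SpecialLinearGroup (Fin 2) 𝕜 →*
    (ClassicalGWA α a ≃ₐ[𝕜] ClassicalGWA α a) :=
  (AlgEquiv.algHomUnitsEquiv 𝕜 (ClassicalGWA α a)).toMonoidHom.comp
    (MonoidHom.toHomUnits
      { toFun := conjHom hα ha
        map_one' := conjHom_one hα ha
        map_mul' := conjHom_mul hα ha })

lemma conj_apply (r : ClassicalGWA α a) : conj hα ha g r = conjHom hα ha g r := rfl

end conj

end ClassicalGWA

/-! ### Filtered automorphisms come from `SL₂`; finite order implies diagonalizable -/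

namespace ClassicalGWA

open Matrix

/-- A nonzero isotropic vector of `𝔰𝔩₂` is the image of a scalar multiple of `E`. -/
lemma exists_isotropic_parameters {𝕜 : Type*} [Field 𝕜] [IsAlgClosed 𝕜] {u v w : 𝕜}
    (h : w ^ 2 + 4 * (u * v) = 0) : ∃ p r : 𝕜, u = p ^ 2 ∧ v = -r ^ 2 ∧ w = -(2 * p * r) := by
  obtain ⟨p, hp⟩ := IsAlgClosed.exists_pow_nat_eq u (n := 2) two_pos
  obtain ⟨r, hr⟩ := IsAlgClosed.exists_pow_nat_eq (-v) (n := 2) two_pos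
  have : (w - 2 * p * r) * (w + 2 * p * r) = 0 := by
    linear_combination h - 4 * p ^ 2 * hr + 4 * v * hp
  rcases mul_eq_zero.1 this with h | h
  · exact ⟨p, -r, hp.symm, by linear_combination hr, by linear_combination h⟩
  · exact ⟨p, r, hp.symm, by linear_combination hr, by linear_combination h⟩

variable {𝕜 : Type u} [Field 𝕜] [CharZero 𝕜] {α : 𝕜} {a : 𝕜[X]}
  (hα : α ≠ 0) (ha : a.natDegree = 2)

/-- Every filtered automorphism is induced by `SL₂`. -/
theorem exists_conj_eq [IsAlgClosed 𝕜] {φ : ClassicalGWA α a ≃ₐ[𝕜] ClassicalGWA α a}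
    (hφ : φ ∈ filteredAut α a) : ∃ g, conj hα ha g = φ := by
  have h2 := coeff_two_ne_zero ha
  obtain ⟨h1, h3, h4, -⟩ := isCasimirTriple_sl hα ha
  obtain ⟨c, e1, e2, e3, hE⟩ := exists_coordinates hα ha hφ (slE_mem_stdFiltration ha)
  obtain ⟨c', f1, f2, f3, hF⟩ := exists_coordinates hα ha hφ (slF_mem_stdFiltration ha)
  obtain ⟨c'', k1, k2, k3, hH⟩ := exists_coordinates hα ha hφ (slH_mem_stdFiltration ha)
  -- Scalars are central, so a commutator of two elements of `𝕜 ⊕ 𝔰𝔩₂` sees only the `𝔰𝔩₂` parts and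
  -- has no constant term.
  have bracket : ∀ c u v w c' u' v' w' : 𝕜,
      (c • 1 + u • slE α a + v • slF α a + w • slH α a) *
        (c' • 1 + u' • slE α a + v' • slF α a + w' • slH α a) =
      (c' • 1 + u' • slE α a + v' • slF α a + w' • slH α a) *
        (c • 1 + u • slE α a + v • slF α a + w • slH α a) +
      ((0 : 𝕜) • 1 + (w * u' - u * w') • slE α a + (v * w' - w * v') • slF α a +
        (2 * (u * v' - v * u')) • slH α a) := by
    intro c u v w c' u' v' w'
    simp only [mul_add, add_mul, smul_mul_assoc, mul_smul_comm, h1, h3, h4, mul_one, one_mul]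
    module
  have h3' : slF α a * slH α a = slH α a * slF α a + slF α a := by rw [h3, sub_add_cancel]
  have r1 := congrArg φ h1
  have r2 := congrArg φ h3'
  have r3 := congrArg φ h4
  simp only [map_mul, map_add, map_smul] at r1 r2 r3
  rw [hE, hH, bracket, add_right_inj] at r1
  rw [hF, hH, bracket, add_right_inj] at r2
  rw [hE, hF, hH, bracket, add_right_inj] at r3
  obtain ⟨rc, rE1, rE2, rE3⟩ := sl_ext hα h2 r1
  obtain ⟨rc', rF1, rF2, rF3⟩ := sl_ext hα h2 r2
  obtain ⟨rc'', rH1, rH2, rH3⟩ := sl_ext (c' := 2 * c'') (u' := 2 * k1) (v' := 2 * k2)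
    (w' := 2 * k3) hα h2 (by rw [r3]; module)
  -- Each of `E, F, H` is, up to a scalar, a bracket, so their images have no constant term.
  subst rc
  subst rc'
  obtain rfl : c'' = 0 := by simpa using rc''.symm
  -- The form `w² + 4uv` is a multiple of the Killing form. By invariance, `[φ H, φ E] = φ E` makes
  -- `φ E` isotropic, and likewise for `φ F`.
  obtain ⟨p, r, rfl, rfl, rfl⟩ := exists_isotropic_parameters (u := e1) (v := e2) (w := e3)
    (by linear_combination -e3 * rE3 - 2 * e2 * rE1 - 2 * e1 * rE2)
  obtain ⟨s, q, rfl, rfl, hf⟩ := exists_isotropic_parameters (u := f2) (v := f1) (w := -f3)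
    (by linear_combination -f3 * rF3 - 2 * f2 * rF1 - 2 * f1 * rF2)
  obtain rfl : f3 = 2 * s * q := neg_injective hf
  -- The relation `[E, F] = 2 H` now determines the image of `H`.
  have hk1 : k1 = -(p * q) * (p * s - q * r) := by linear_combination (-1 / 2 : 𝕜) * rH1
  have hk2 : k2 = r * s * (p * s - q * r) := by linear_combination (-1 / 2 : 𝕜) * rH2
  have hk3 : k3 = (p * s + q * r) * (p * s - q * r) := by linear_combination (-1 / 2 : 𝕜) * rH3
  subst hk1 hk2 hk3
  -- Substituting in `[H, E] = E` multiplies `φ E` by the square of `p * s - q * r`. Since `φ E ≠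
  -- 0`, one of `p, r` is nonzero and can be cancelled.
  have hD : (p * s - q * r - 1) * (p * s - q * r + 1) = 0 := by
    by_cases hp : p = 0
    · have hr : r ≠ 0 := by
        rintro rfl
        have h0 : φ (slE α a) = φ 0 := by rw [hE, hp, map_zero]; simp
        have := sl_independent (c := 0) (u := 1) (v := 0) (w := 0) hα h2
          (by rw [φ.injective h0]; simp)
        simp at this
      refine (mul_eq_zero.1 (?_ : r ^ 2 * _ = 0)).resolve_left (pow_ne_zero 2 hr)
      linear_combination -rE2
    · refine (mul_eq_zero.1 (?_ : p ^ 2 * _ = 0)).resolve_left (pow_ne_zero 2 hp)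
      linear_combination rE1
  -- Changing the sign of `q` and `s` together leaves `φ F` unchanged and corrects the determinant
  -- from `-1` to `1`.
  have hDH : ∀ ε : 𝕜, ε * (p * s - q * r) = 1 → ε ^ 2 = 1 → ∃ g, conj hα ha g = φ := by
    intro ε hε hε2
    have hD1 : p * s - q * r = ε := by linear_combination ε * hε - (p * s - q * r) * hε2
    let g : SpecialLinearGroup (Fin 2) 𝕜 := ⟨!![p, ε * q; r, ε * s], by
      rw [Matrix.det_fin_two_of]; linear_combination hε⟩
    have g00 : g 0 0 = p := rfl
    have g01 : g 0 1 = ε * q := rfl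
    have g10 : g 1 0 = r := rfl
    have g11 : g 1 1 = ε * s := rfl
    have key : (conjHom hα ha g) = φ.toAlgHom := by
      refine algHom_ext_sl hα h2 ?_ ?_ ?_
      · change _ = φ _
        rw [hE, conjHom_slE, g00, g10]
        module
      · change _ = φ _
        rw [hF, conjHom_slF, g01, g11]
        match_scalars
        · linear_combination -q ^ 2 * hε2
        · linear_combination s ^ 2 * hε2
        · linear_combination 2 * s * q * hε2
        · simp
      · change _ = φ _
        rw [hH, conjHom_slH, g00, g01, g10, g11, hD1]
        module
    exact ⟨g, AlgEquiv.ext fun x => by rw [conj_apply, key]; rfl⟩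
  rcases mul_eq_zero.1 hD with h | h
  · exact hDH 1 (by linear_combination h) (by ring)
  · exact hDH (-1) (by linear_combination -h) (by ring)

omit [CharZero 𝕜] in
lemma sl2_ext {g h : SpecialLinearGroup (Fin 2) 𝕜} (h00 : g 0 0 = h 0 0) (h01 : g 0 1 = h 0 1)
    (h10 : g 1 0 = h 1 0) (h11 : g 1 1 = h 1 1) : g = h := by
  refine Subtype.ext (Matrix.ext fun i j => ?_)
  match i, j with
  | 0, 0 => exact h00
  | 0, 1 => exact h01
  | 1, 0 => exact h10
  | 1, 1 => exact h11

/-- The diagonal matrix with entries `t` and `t⁻¹`. -/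
noncomputable def diagSL (t : 𝕜ˣ) : SpecialLinearGroup (Fin 2) 𝕜 :=
  ⟨!![(t : 𝕜), 0; 0, (t⁻¹ : 𝕜ˣ)], by simp⟩

/-- Over an algebraically closed field every matrix of determinant one is conjugate to an upper
triangular one, which is diagonal or has equal diagonal entries. -/
theorem exists_triangular [IsAlgClosed 𝕜] (g : SpecialLinearGroup (Fin 2) 𝕜) :
    ∃ P B : SpecialLinearGroup (Fin 2) 𝕜, g * P = P * B ∧ B 1 0 = 0 := by
  obtain ⟨l, hl⟩ := IsAlgClosed.exists_root
    (X ^ 2 + C (-(g 0 0 + g 1 1)) * X + C 1 : 𝕜[X]) (by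
      rw [← one_mul (X ^ 2 : 𝕜[X]), ← C_1, degree_quadratic one_ne_zero]; norm_num)
  have hl' : l ^ 2 - (g 0 0 + g 1 1) * l + 1 = 0 := by
    simp only [IsRoot.def, eval_add, eval_mul, eval_pow, eval_X, eval_C] at hl
    linear_combination hl
  have hdet := det_eq g
  obtain ⟨v, hv, hgv⟩ := (Matrix.exists_mulVec_eq_zero_iff
    (M := !![g 0 0 - l, g 0 1; g 1 0, g 1 1 - l])).2 (by
      rw [Matrix.det_fin_two_of]; linear_combination hl' + hdet)
  have e0 := congrFun hgv 0
  have e1 := congrFun hgv 1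
  simp [Matrix.mulVec, dotProduct, Fin.sum_univ_two] at e0 e1
  -- Completes the eigenvector `v` to a basis of determinant one.
  obtain ⟨q, s, hqs⟩ : ∃ q s, v 0 * s - q * v 1 = 1 := by
    by_cases h0 : v 0 = 0
    · have h1 : v 1 ≠ 0 := fun h1 => hv (by ext i; fin_cases i <;> simp [h0, h1])
      exact ⟨-(v 1)⁻¹, 0, by simp [h1]⟩
    · exact ⟨0, (v 0)⁻¹, by simp [h0]⟩
  let P : SpecialLinearGroup (Fin 2) 𝕜 := ⟨!![v 0, q; v 1, s], by
    rw [Matrix.det_fin_two_of]; linear_combination hqs⟩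
  refine ⟨P, P⁻¹ * (g * P), (mul_inv_cancel_left P (g * P)).symm, ?_⟩
  have : (P⁻¹ * (g * P)) 1 0 =
      -v 1 * (g 0 0 * v 0 + g 0 1 * v 1) + v 0 * (g 1 0 * v 0 + g 1 1 * v 1) := by
    change ((P⁻¹ : SpecialLinearGroup (Fin 2) 𝕜).1 * (g.1 * P.1)) 1 0 = _
    have hinv : (P⁻¹ : SpecialLinearGroup (Fin 2) 𝕜).1 = !![s, -q; -v 1, v 0] := by
      rw [SpecialLinearGroup.SL2_inv_expl]; rfl
    rw [hinv, Matrix.mul_apply, Fin.sum_univ_two, Matrix.mul_apply, Matrix.mul_apply,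
      Fin.sum_univ_two, Fin.sum_univ_two]
    rfl
  rw [this]
  linear_combination -v 1 * e0 + v 0 * e1

/-- A triangular matrix with both diagonal entries `1` or both `-1` translates `H` by a multiple of
`E`, and the translations add up under powers. In characteristic zero, finite order therefore forces
the corner entry to vanish. -/
theorem conj_triangular_pow_slH {B : SpecialLinearGroup (Fin 2) 𝕜} (h10 : B 1 0 = 0)
    (hB : B 0 0 ^ 2 = 1) (n : ℕ) :
    (conj hα ha B ^ n) (slH α a) = slH α a - (n * (B 0 0 * B 0 1)) • slE α a := by
  have hdet := det_eq B
  rw [h10, mul_zero, sub_zero] at hdet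
  induction n with
  | zero => simp
  | succ n ih =>
    rw [pow_succ', AlgEquiv.mul_apply, ih, map_sub, map_smul, conj_apply, conj_apply, conjHom_slH,
      conjHom_slE, h10, hdet, hB]
    push_cast
    module

/-- Triangularize first. If the two diagonal entries differ, the matrix is diagonalizable; if they
agree, finite order excludes a unipotent part by `conj_triangular_pow_slH`. -/
theorem exists_diag_of_isOfFinOrder [IsAlgClosed 𝕜] {g : SpecialLinearGroup (Fin 2) 𝕜}
    (hg : IsOfFinOrder (conj hα ha g)) :
    ∃ P t, conj hα ha g = conj hα ha P * conj hα ha (diagSL t) * (conj hα ha P)⁻¹ := by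
  obtain ⟨P, B, hPB, h10⟩ := exists_triangular g
  have hdet := det_eq B
  rw [h10, mul_zero, sub_zero] at hdet
  have hconj : ∀ P' : SpecialLinearGroup (Fin 2) 𝕜, ∀ t, B * P' = P' * diagSL t →
      conj hα ha g = conj hα ha (P * P') * conj hα ha (diagSL t) * (conj hα ha (P * P'))⁻¹ := by
    intro P' t h
    rw [eq_mul_inv_iff_mul_eq, ← map_mul, ← map_mul, ← mul_assoc, hPB, mul_assoc, h, mul_assoc]
  have hB0 : B 0 0 ≠ 0 := left_ne_zero_of_mul_eq_one hdet
  have hB1 : (B 0 0)⁻¹ = B 1 1 := inv_eq_of_mul_eq_one_right hdet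
  by_cases hB : B 0 0 ^ 2 = 1
  · have hfin : IsOfFinOrder (conj hα ha B) := by
      obtain ⟨n, hn, hn1⟩ := isOfFinOrder_iff_pow_eq_one.1 hg
      refine isOfFinOrder_iff_pow_eq_one.2 ⟨n, hn, ?_⟩
      have : conj hα ha B = (conj hα ha P)⁻¹ * conj hα ha g * conj hα ha P := by
        rw [mul_assoc, ← map_mul, hPB, map_mul, inv_mul_cancel_left]
      have h' := conj_pow (i := n) (a := (conj hα ha P)⁻¹) (b := conj hα ha g)
      rw [inv_inv] at h'
      rw [this, h', hn1, mul_one, inv_mul_cancel]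
    obtain ⟨n, hn, hn1⟩ := isOfFinOrder_iff_pow_eq_one.1 hfin
    have h01 : B 0 1 = 0 := by
      have h := conj_triangular_pow_slH hα ha h10 hB n
      rw [hn1, AlgEquiv.one_apply] at h
      have := sl_independent (c := 0) (u := n * (B 0 0 * B 0 1)) (v := 0) (w := 0) hα
        (coeff_two_ne_zero ha) (by
          rw [eq_sub_iff_add_eq, add_eq_left] at h
          rw [h]; simp)
      have h' := this.2.1
      simpa [hn.ne', hB0] using h'
    refine ⟨P * 1, Units.mk0 _ hB0, hconj 1 _ ?_⟩
    rw [mul_one, one_mul]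
    refine sl2_ext rfl h01 h10 ?_
    rw [← hB1]
    rfl
  -- The entry `c` makes the second column of `P'` an eigenvector of `B` for `B 1 1`.
  · let c : 𝕜 := B 0 1 / (B 1 1 - B 0 0)
    have hne : B 1 1 - B 0 0 ≠ 0 := fun h => hB (by linear_combination hdet - B 0 0 * h)
    let P' : SpecialLinearGroup (Fin 2) 𝕜 := ⟨!![1, c; 0, 1], by simp⟩
    refine ⟨P * P', Units.mk0 _ hB0, hconj P' _ ?_⟩
    have hc : B 0 0 * c + B 0 1 = c * B 1 1 := by
      simp only [c]; field_simp; ring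
    have d11 : diagSL (Units.mk0 _ hB0) 1 1 = B 1 1 := hB1
    have d00 : diagSL (Units.mk0 _ hB0) 0 0 = B 0 0 := rfl
    have d01 : diagSL (Units.mk0 _ hB0) 0 1 = 0 := rfl
    have d10 : diagSL (Units.mk0 _ hB0) 1 0 = 0 := rfl
    have p00 : P' 0 0 = 1 := rfl
    have p01 : P' 0 1 = c := rfl
    have p10 : P' 1 0 = 0 := rfl
    have p11 : P' 1 1 = 1 := rfl
    apply sl2_ext <;> rw [sl2_mul_apply, sl2_mul_apply] <;>
      simp only [d00, d01, d10, d11, p00, p01, p10, p11, h10]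
    · ring
    · linear_combination hc
    · ring
    · ring

end ClassicalGWA

/-! ### Trace spaces -/

section traceDim

/-- The span of the commutators of an algebra. -/
def commutatorSpan (𝕜 A : Type*) [Field 𝕜] [Ring A] [Algebra 𝕜 A] : Submodule 𝕜 A :=
  Submodule.span 𝕜 {r | ∃ u v : A, r = u * v - v * u}

/-- The dimension of the space of traces `A / [A, A]`. -/
noncomputable def traceDim (𝕜 A : Type*) [Field 𝕜] [Ring A] [Algebra 𝕜 A] : ℕ :=
  Module.finrank 𝕜 (A ⧸ commutatorSpan 𝕜 A)

lemma commutator_mem_commutatorSpan (𝕜 : Type*) {A : Type*} [Field 𝕜] [Ring A] [Algebra 𝕜 A]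
    (u v : A) : u * v - v * u ∈ commutatorSpan 𝕜 A := Submodule.subset_span ⟨u, v, rfl⟩

theorem traceDim_congr {𝕜 A B : Type*} [Field 𝕜] [Ring A] [Algebra 𝕜 A] [Ring B] [Algebra 𝕜 B]
    (e : A ≃ₐ[𝕜] B) : traceDim 𝕜 A = traceDim 𝕜 B := by
  refine LinearEquiv.finrank_eq (Submodule.Quotient.equiv _ _ e.toLinearEquiv ?_)
  rw [commutatorSpan, Submodule.map_span, commutatorSpan]
  congr 1
  ext r
  constructor
  · rintro ⟨_, ⟨u, v, rfl⟩, rfl⟩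
    exact ⟨e u, e v, by simp⟩
  · rintro ⟨u, v, rfl⟩
    exact ⟨_, ⟨e.symm u, e.symm v, rfl⟩, by simp⟩

end traceDim

/-! ### Cokernels of degree-raising maps on polynomials -/

namespace Polynomial

variable {𝕜 : Type*} [Field 𝕜]

/-- The cokernel of a linear endomorphism of `𝕜[X]` that raises degrees by `d` has dimension
`d`. -/
theorem finrank_quotient_range_of_natDegree (T : 𝕜[X] →ₗ[𝕜] 𝕜[X]) {d : ℕ} (hd : 0 < d)
    (hT : ∀ g, g ≠ 0 → (T g).natDegree = g.natDegree + d) :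
    Module.finrank 𝕜 (𝕜[X] ⧸ LinearMap.range T) = d := by
  have hT0 : ∀ g, g ≠ 0 → T g ≠ 0 := fun g hg h => by
    have := hT g hg
    rw [h, natDegree_zero] at this
    omega
  -- Polynomials of degree below `d` form a complement of the range: its nonzero elements have
  -- degree at least `d`, and cancelling leading terms reduces any polynomial to one of degree below
  -- `d`.
  have hcompl : IsCompl (LinearMap.range T) (degreeLT 𝕜 d) := by
    constructor
    · rw [Submodule.disjoint_def]
      rintro _ ⟨g, rfl⟩ hg
      by_contra h
      have hg0 : g ≠ 0 := by rintro rfl; simp at h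
      rw [mem_degreeLT, degree_eq_natDegree h, hT g hg0, Nat.cast_lt] at hg
      omega
    · rw [codisjoint_iff, eq_top_iff]
      rintro p -
      induction hn : p.natDegree using Nat.strong_induction_on generalizing p with
      | _ n ih =>
        by_cases hp : p = 0
        · rw [hp]; exact zero_mem _
        by_cases hnd : n < d
        · refine Submodule.mem_sup_right (mem_degreeLT.2 ?_)
          rw [degree_eq_natDegree hp, hn]
          exact_mod_cast hnd
        · have hX : (X ^ (n - d) : 𝕜[X]) ≠ 0 := pow_ne_zero _ X_ne_zero
          have hq := hT0 _ hX
          have hlc : (T (X ^ (n - d))).leadingCoeff ≠ 0 := leadingCoeff_ne_zero.2 hq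
          set c := p.leadingCoeff / (T (X ^ (n - d))).leadingCoeff with hc
          have hc0 : c ≠ 0 := div_ne_zero (leadingCoeff_ne_zero.2 hp) hlc
          have hdeg : (c • T (X ^ (n - d))).natDegree = n := by
            rw [natDegree_smul _ hc0, hT _ hX, natDegree_X_pow]; omega
          have hsub : p - c • T (X ^ (n - d)) ∈ LinearMap.range T ⊔ degreeLT 𝕜 d := by
            by_cases h0 : p - c • T (X ^ (n - d)) = 0
            · rw [h0]; exact zero_mem _
            refine ih _ ?_ rfl
            refine (natDegree_lt_natDegree h0 (degree_sub_lt_left ?_ hp ?_)).trans_eq hn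
            · rw [degree_eq_natDegree hp, degree_eq_natDegree (smul_ne_zero hc0 hq), hn, hdeg]
            · rw [smul_eq_C_mul, leadingCoeff_mul, leadingCoeff_C, hc, div_mul_cancel₀ _ hlc]
          rw [← sub_add_cancel p (c • T (X ^ (n - d)))]
          exact add_mem hsub (Submodule.mem_sup_left (Submodule.smul_mem _ _ ⟨_, rfl⟩))
  rw [(Submodule.quotientEquivOfIsCompl _ _ hcompl).finrank_eq,
    (degreeLTEquiv 𝕜 d).finrank_eq, Module.finrank_fin_fun]

/-- Differences lower the degree by exactly one in characteristic zero. -/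
theorem natDegree_comp_X_add_C_sub [CharZero 𝕜] {p : 𝕜[X]} (hp : p.natDegree ≠ 0) {b : 𝕜}
    (hb : b ≠ 0) : (p.comp (X + C b) - p).natDegree = p.natDegree - 1 := by
  obtain ⟨n, hn⟩ := Nat.exists_eq_succ_of_ne_zero hp
  have hp0 : p ≠ 0 := by rintro rfl; simp at hp
  have hcoeff : (p.comp (X + C b) - p).coeff n = (n + 1) * b * p.leadingCoeff := by
    -- The Taylor coefficient of index `n` is a Hasse derivative evaluated at `b`. For `deg p = n +
    -- 1` it is affine in `b`, and its constant term cancels against `p`.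
    have hlin : (hasseDeriv n p).natDegree ≤ 1 := by
      refine (natDegree_hasseDeriv_le p n).trans ?_
      omega
    rw [coeff_sub, ← taylor_apply, taylor_coeff, eval_eq_sum_range' (Nat.lt_succ_of_le hlin),
      Finset.sum_range_succ, Finset.sum_range_one, hasseDeriv_coeff, hasseDeriv_coeff, leadingCoeff,
      hn, zero_add, add_comm 1 n, Nat.choose_self, Nat.choose_succ_self_right]
    push_cast
    ring
  have hne : (p.comp (X + C b) - p).coeff n ≠ 0 := by
    rw [hcoeff]
    exact mul_ne_zero (mul_ne_zero (Nat.cast_add_one_ne_zero n) hb) (leadingCoeff_ne_zero.2 hp0)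
  refine le_antisymm ?_ ?_
  · have hdeg : (p.comp (X + C b)).natDegree = p.natDegree := by
      rw [natDegree_comp, natDegree_X_add_C, mul_one]
    have hcomp0 : p.comp (X + C b) ≠ 0 := by
      rintro h; rw [h, natDegree_zero] at hdeg; exact hp hdeg.symm
    refine Nat.le_sub_one_of_lt ?_
    conv_rhs => rw [← hdeg]
    refine natDegree_lt_natDegree (fun h => by simp [h] at hne) (degree_sub_lt_left ?_ hcomp0 ?_)
    · rw [degree_eq_natDegree hp0, degree_eq_natDegree hcomp0, hdeg]
    · rw [leadingCoeff_comp (by rw [natDegree_X_add_C]; exact one_ne_zero), leadingCoeff_X_add_C,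
        one_pow, mul_one]
  · rw [hn, Nat.succ_sub_one]
    exact le_natDegree_of_ne_zero hne

end Polynomial

/-! ### Relations in the component of degree zero -/

namespace ClassicalGWA

variable {𝕜 : Type u} [Field 𝕜] {α : 𝕜} {a : 𝕜[X]}

lemma shift_inv_pow_X (n : ℕ) :
    ((algEquivAevalXAddC (-α))⁻¹ ^ n) (X : 𝕜[X]) = X + C (n * α) := by
  have h : (algEquivAevalXAddC (-α) ^ n) (X + C (n * α) : 𝕜[X]) = X := by
    rw [shift_pow_apply, add_comp, X_comp, C_comp, C_neg, neg_add_cancel_right]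
  conv_lhs => rw [← h]
  rw [← AlgEquiv.mul_apply, inv_pow, inv_mul_cancel, AlgEquiv.one_apply]

lemma natDegree_shift_pow (n : ℕ) (d : 𝕜[X]) :
    ((algEquivAevalXAddC (-α) ^ n) d).natDegree = d.natDegree := by
  rw [shift_pow_apply, natDegree_comp, natDegree_X_add_C, mul_one]

lemma natDegree_twistedPow (ha : a ≠ 0) (n : ℕ) :
    (GWA.twistedPow (algEquivAevalXAddC (-α)) a n).natDegree = n * a.natDegree := by
  rw [GWA.twistedPow, natDegree_prod _ _ fun j _ => by simpa using ha]
  have : ∀ j, (((algEquivAevalXAddC (-α))⁻¹ ^ j) a).natDegree = a.natDegree := fun j => by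
    conv_rhs => rw [← AlgEquiv.one_apply (R := 𝕜) a, ← mul_inv_cancel (algEquivAevalXAddC (-α) ^ j),
      AlgEquiv.mul_apply, natDegree_shift_pow, ← inv_pow]
  rw [Finset.sum_congr rfl fun j _ => this j, Finset.sum_const, Finset.card_range, smul_eq_mul]

variable (α a) in
/-- The map `g ↦ (σᵐ - 1)(B g)`, where `B = yᵐ xᵐ`. -/
noncomputable def traceRelation (m : ℕ) : 𝕜[X] →ₗ[𝕜] 𝕜[X] :=
  ((algEquivAevalXAddC (-α) ^ m).toLinearMap - LinearMap.id) ∘ₗ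
    LinearMap.mulLeft 𝕜 (GWA.twistedPow (algEquivAevalXAddC (-α)) a m)

lemma traceRelation_apply (m : ℕ) (g : 𝕜[X]) :
    traceRelation α a m g = (algEquivAevalXAddC (-α) ^ m)
      (GWA.twistedPow (algEquivAevalXAddC (-α)) a m * g) -
      GWA.twistedPow (algEquivAevalXAddC (-α)) a m * g := rfl

/-- Multiplication by `B` adds `2 * m` to the degree, and the difference operator `σᵐ - 1` takes one
away. -/
theorem finrank_quotient_traceRelation [CharZero 𝕜] (hα : α ≠ 0) (ha : a.natDegree = 2) {m : ℕ}
    (hm : 0 < m) : Module.finrank 𝕜 (𝕜[X] ⧸ LinearMap.range (traceRelation α a m)) = 2 * m - 1 := by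
  refine finrank_quotient_range_of_natDegree _ (by omega) fun g hg => ?_
  have ha0 : a ≠ 0 := by rintro rfl; simp at ha
  have hB := natDegree_twistedPow (α := α) ha0 m
  have hB0 : GWA.twistedPow (algEquivAevalXAddC (-α)) a m ≠ 0 := by
    rintro h; rw [h, natDegree_zero, ha] at hB; omega
  have hdeg := natDegree_mul hB0 hg
  rw [hB, ha] at hdeg
  rw [traceRelation_apply, shift_pow_apply, natDegree_comp_X_add_C_sub (by omega)
    (neg_ne_zero.2 (mul_ne_zero (Nat.cast_ne_zero.2 hm.ne') hα)), hdeg]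
  omega

/-- Telescoping `σ^(m i) - 1` in steps of `σ^m` shows that commutators of higher powers of `x` and
`y` impose no relations beyond those of `xᵐ` and `yᵐ`. -/
lemma shift_pow_mul_sub_mem (m i : ℕ) (h : 𝕜[X]) :
    (algEquivAevalXAddC (-α) ^ (m * i)) (h * GWA.twistedPow (algEquivAevalXAddC (-α)) a (m * i)) -
      h * GWA.twistedPow (algEquivAevalXAddC (-α)) a (m * i) ∈
      LinearMap.range (traceRelation α a m) := by
  set s := algEquivAevalXAddC (-α) with hs
  set c := h * GWA.twistedPow s a (m * i) with hc
  have hsum := Finset.sum_range_sub (fun l => (s ^ (m * l)) c) i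
  simp only [mul_zero, pow_zero, AlgEquiv.one_apply] at hsum
  rw [← hsum]
  refine Submodule.sum_mem _ fun l hl => ?_
  -- The `l`-th block of the long product becomes the unshifted block under `σ^(m l)`, so each
  -- telescoping term has the form `(σᵐ - 1)(B g)`.
  have hdvd : GWA.twistedPow s a m ∣ (s ^ (m * l)) c := by
    have h1 : (s⁻¹ ^ (m * l)) (GWA.twistedPow s a m) ∣ c := by
      rw [hc, GWA.twistedPow_mul]
      exact (Finset.dvd_prod_of_mem (fun l => (s⁻¹ ^ (m * l)) (GWA.twistedPow s a m)) hl).mul_left h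
    have h2 := map_dvd (s ^ (m * l)) h1
    rwa [← AlgEquiv.mul_apply, inv_pow, mul_inv_cancel, AlgEquiv.one_apply] at h2
  obtain ⟨g, hg⟩ := hdvd
  refine ⟨g, ?_⟩
  rw [traceRelation_apply, ← hg, ← AlgEquiv.mul_apply, ← pow_add, mul_add_one, add_comm m]

variable (α a) in
/-- The monomials whose weight is divisible by `m`. -/
noncomputable def monomialsOfDvd (m : ℕ) : Set (ClassicalGWA α a) :=
  {r | ∃ d i, r = GWA.coeff _ a d * GWA.x _ a ^ (m * i)} ∪
    {r | ∃ d i, r = GWA.coeff _ a d * GWA.y _ a ^ (m * i)}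

/-- Only pairs of opposite weights, or both of weight zero, can contribute. In weight zero
everything commutes, and opposite weights give an element covered by `shift_pow_mul_sub_mem`. -/
lemma degreeZero_commutator_mem {m : ℕ} (hm : 0 < m) {u v : ClassicalGWA α a}
    (hu : u ∈ monomialsOfDvd α a m) (hv : v ∈ monomialsOfDvd α a m) :
    GWA.degreeZero _ a (u * v - v * u) ∈ LinearMap.range (traceRelation α a m) := by
  have wx : ∀ (d : 𝕜[X]) (n : ℕ), GWA.coeff _ a d * GWA.x _ a ^ n ∈ GWA.weightSpace (algEquivAevalXAddC (-α)) a n :=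
    fun d n => by
      simpa using GWA.mul_mem_weightSpace (GWA.coeff_mem_weightSpace _ a d)
        (GWA.x_pow_mem_weightSpace _ a n)
  have wy : ∀ (d : 𝕜[X]) (n : ℕ), GWA.coeff _ a d * GWA.y _ a ^ n ∈
      GWA.weightSpace (algEquivAevalXAddC (-α)) a (-n) := fun d n => by
    simpa using GWA.mul_mem_weightSpace (GWA.coeff_mem_weightSpace _ a d)
      (GWA.y_pow_mem_weightSpace _ a n)
  have zero : ∀ {u v : ClassicalGWA α a} {k l : ℤ}, u ∈ GWA.weightSpace _ a k →
      v ∈ GWA.weightSpace _ a l → k + l ≠ 0 →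
      GWA.degreeZero _ a (u * v - v * u) ∈ LinearMap.range (traceRelation α a m) := by
    intro u v k l hu hv hkl
    rw [map_sub, GWA.degreeZero_of_mem_weightSpace _ a hkl (GWA.mul_mem_weightSpace hu hv),
      GWA.degreeZero_of_mem_weightSpace _ a (by rwa [add_comm]) (GWA.mul_mem_weightSpace hv hu),
      sub_zero]
    exact zero_mem _
  have comm : ∀ d e : 𝕜[X], GWA.coeff (algEquivAevalXAddC (-α)) a d * GWA.coeff _ a e -
      GWA.coeff _ a e * GWA.coeff _ a d = 0 := fun d e => by
    rw [← map_mul, ← map_mul, mul_comm, sub_self]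
  have mixed : ∀ (d e : 𝕜[X]) (i j : ℕ),
      GWA.degreeZero (algEquivAevalXAddC (-α)) a (GWA.coeff _ a d * GWA.x _ a ^ (m * i) *
        (GWA.coeff _ a e * GWA.y _ a ^ (m * j)) - GWA.coeff _ a e * GWA.y _ a ^ (m * j) *
        (GWA.coeff _ a d * GWA.x _ a ^ (m * i))) ∈ LinearMap.range (traceRelation α a m) := by
    intro d e i j
    by_cases hij : i = j
    · subst hij
      have := shift_pow_mul_sub_mem (α := α) (a := a) m i
        (e * ((algEquivAevalXAddC (-α))⁻¹ ^ (m * i)) d)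
      convert this using 1
      rw [map_sub]
      congr 1
      · rw [mul_assoc, ← mul_assoc (GWA.x _ a ^ (m * i)), GWA.x_pow_mul_coeff, mul_assoc,
          GWA.x_pow_mul_y_pow, ← map_mul, ← map_mul, GWA.degreeZero_coeff, map_mul, map_mul,
          ← AlgEquiv.mul_apply, inv_pow, mul_inv_cancel, AlgEquiv.one_apply]
        ring
      · rw [mul_assoc, ← mul_assoc (GWA.y _ a ^ (m * i)), GWA.y_pow_mul_coeff, mul_assoc,
          GWA.y_pow_mul_x_pow, ← map_mul, ← map_mul, GWA.degreeZero_coeff, mul_assoc]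
    · refine zero (wx _ _) (wy _ _) ?_
      rw [← sub_eq_add_neg, sub_ne_zero]
      exact_mod_cast fun h => hij (Nat.eq_of_mul_eq_mul_left hm h)
  rcases hu with ⟨d, i, rfl⟩ | ⟨d, i, rfl⟩ <;> rcases hv with ⟨e, j, rfl⟩ | ⟨e, j, rfl⟩
  · by_cases hij : i + j = 0
    · obtain ⟨rfl, rfl⟩ := Nat.add_eq_zero_iff.1 hij
      simp only [mul_zero, pow_zero, mul_one, comm, map_zero]
      exact zero_mem _
    · refine zero (wx _ _) (wx _ _) ?_
      rw [← Nat.cast_add, ← mul_add, Nat.cast_ne_zero]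
      exact mul_ne_zero hm.ne' hij
  · exact mixed d e i j
  · rw [← neg_sub, map_neg]
    exact neg_mem (mixed e d j i)
  · by_cases hij : i + j = 0
    · obtain ⟨rfl, rfl⟩ := Nat.add_eq_zero_iff.1 hij
      simp only [mul_zero, pow_zero, mul_one, comm, map_zero]
      exact zero_mem _
    · refine zero (wy _ _) (wy _ _) ?_
      rw [← neg_add, neg_ne_zero, ← Nat.cast_add, ← mul_add, Nat.cast_ne_zero]
      exact mul_ne_zero hm.ne' hij

lemma degreeZero_commutator_mem_of_mem_span {m : ℕ} (hm : 0 < m) {u v : ClassicalGWA α a}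
    (hu : u ∈ Submodule.span 𝕜 (monomialsOfDvd α a m))
    (hv : v ∈ Submodule.span 𝕜 (monomialsOfDvd α a m)) :
    GWA.degreeZero _ a (u * v - v * u) ∈ LinearMap.range (traceRelation α a m) := by
  have h1 : ∀ u ∈ monomialsOfDvd α a m, Submodule.span 𝕜 (monomialsOfDvd α a m) ≤
      (LinearMap.range (traceRelation α a m)).comap (GWA.degreeZero _ a ∘ₗ
        (LinearMap.mulLeft 𝕜 u - LinearMap.mulRight 𝕜 u)) := fun u hu =>
    Submodule.span_le.2 fun v hv => degreeZero_commutator_mem hm hu hv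
  have h2 : Submodule.span 𝕜 (monomialsOfDvd α a m) ≤
      (LinearMap.range (traceRelation α a m)).comap (GWA.degreeZero _ a ∘ₗ
        (LinearMap.mulRight 𝕜 v - LinearMap.mulLeft 𝕜 v)) :=
    Submodule.span_le.2 fun u hu => h1 u hu hv
  exact h2 hu

/-! ### Fixed rings of diagonal automorphisms and their trace spaces -/

section fixed

variable [CharZero 𝕜] {θ : ClassicalGWA α a ≃ₐ[𝕜] ClassicalGWA α a} {ω : 𝕜} {m : ℕ}

omit [CharZero 𝕜] in
lemma mem_fixedRing_zpowers {R : Type u} [Ring R] [Algebra 𝕜 R] {θ : R ≃ₐ[𝕜] R} {r : R} :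
    r ∈ fixedRing (Subgroup.zpowers θ) ↔ θ r = r := by
  constructor
  · intro h
    exact h ⟨θ, Subgroup.mem_zpowers θ⟩
  · rintro h ⟨g, hg⟩
    have : Subgroup.zpowers θ ≤ MulAction.stabilizer (R ≃ₐ[𝕜] R) r := by
      rw [Subgroup.zpowers_le]; exact h
    exact this hg

/-- The fixed ring of a diagonal automorphism is spanned by monomials. -/
theorem fixed_mem_span (hω : IsPrimitiveRoot ω m) (hm : 0 < m)
    (hc : ∀ d, θ (GWA.coeff _ a d) = GWA.coeff _ a d) (hx : θ (GWA.x _ a) = ω • GWA.x _ a)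
    (hy : θ (GWA.y _ a) = ω⁻¹ • GWA.y _ a) {r : ClassicalGWA α a} (hr : θ r = r) :
    r ∈ Submodule.span 𝕜 (monomialsOfDvd α a m) := by
  -- The Reynolds operator of the powers of `θ`: it fixes invariants and, by a geometric sum, kills
  -- monomials of weight not divisible by `m`.
  let avg : ClassicalGWA α a →ₗ[𝕜] ClassicalGWA α a :=
    (m : 𝕜)⁻¹ • ∑ j ∈ Finset.range m, (θ ^ j).toLinearMap
  have havg : ∀ r, avg r = (m : 𝕜)⁻¹ • ∑ j ∈ Finset.range m, (θ ^ j) r := fun r => by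
    simp [avg]
  have hm0 : (m : 𝕜) ≠ 0 := Nat.cast_ne_zero.2 hm.ne'
  have hpow : ∀ {η : 𝕜} {w : ClassicalGWA α a}, θ w = η • w → ∀ j : ℕ, (θ ^ j) w = η ^ j • w := by
    intro η w hw j
    induction j with
    | zero => simp
    | succ j ih => rw [pow_succ', AlgEquiv.mul_apply, ih, map_smul, hw, smul_smul, pow_succ]
  have hfix : ∀ {r}, θ r = r → avg r = r := fun {r} hr => by
    have hr' : θ r = (1 : 𝕜) • r := by rw [hr, one_smul]
    rw [havg, Finset.sum_congr rfl fun j _ => hpow hr' j]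
    simp only [one_pow, one_smul, Finset.sum_const, Finset.card_range]
    rw [← Nat.cast_smul_eq_nsmul 𝕜, smul_smul, inv_mul_cancel₀ hm0, one_smul]
  have hzero : ∀ {η : 𝕜} {w : ClassicalGWA α a}, θ w = η • w → η ^ m = 1 → η ≠ 1 → avg w = 0 := by
    intro η w hw h1 hne
    rw [havg, Finset.sum_congr rfl fun j _ => hpow hw j, ← Finset.sum_smul, geom_sum_eq hne, h1,
      sub_self, zero_div, zero_smul, smul_zero]
  have hall : (⊤ : Submodule 𝕜 (ClassicalGWA α a)) ≤
      (Submodule.span 𝕜 (monomialsOfDvd α a m)).comap avg := by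
    rw [← GWA.span_monomials, Submodule.span_le]
    have main : ∀ {η : 𝕜} {w : ClassicalGWA α a}, IsPrimitiveRoot η m → θ w = η • w →
        ∀ d n, (∀ i, GWA.coeff _ a d * w ^ (m * i) ∈ monomialsOfDvd α a m) →
        avg (GWA.coeff _ a d * w ^ n) ∈ Submodule.span 𝕜 (monomialsOfDvd α a m) := by
      intro η w hη hw d n hmem
      have hdn : θ (GWA.coeff _ a d * w ^ n) = η ^ n • (GWA.coeff _ a d * w ^ n) := by
        rw [map_mul, hc, map_pow, hw, _root_.smul_pow, mul_smul_comm]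
      by_cases h : η ^ n = 1
      · obtain ⟨i, rfl⟩ := (hη.pow_eq_one_iff_dvd n).1 h
        rw [hfix (by rw [hdn, h, one_smul])]
        exact Submodule.subset_span (hmem i)
      · rw [hzero hdn (by rw [← pow_mul, mul_comm, pow_mul, hη.pow_eq_one, one_pow]) h]
        exact zero_mem _
    rintro _ (⟨d, n, rfl⟩ | ⟨d, n, rfl⟩)
    · exact main hω hx d n fun i => Or.inl ⟨d, i, rfl⟩
    · exact main hω.inv hy d n fun i => Or.inr ⟨d, i, rfl⟩
  have := hall (Submodule.mem_top (x := r))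
  rwa [Submodule.mem_comap, hfix hr] at this

/-- The trace space of the fixed ring of a diagonal automorphism of order `m`, given as an algebra
`A` with an embedding `j`. -/
theorem traceDim_of_fixed_diag {A : Type*} [Ring A] [Algebra 𝕜 A] (j : A →ₐ[𝕜] ClassicalGWA α a)
    (hj : Function.Injective j) (hjθ : ∀ r, (∃ s, j s = r) ↔ θ r = r)
    (hα : α ≠ 0) (ha : a.natDegree = 2) (hω : IsPrimitiveRoot ω m)
    (hm : 0 < m) (hc : ∀ d, θ (GWA.coeff _ a d) = GWA.coeff _ a d)
    (hx : θ (GWA.x _ a) = ω • GWA.x _ a) (hy : θ (GWA.y _ a) = ω⁻¹ • GWA.y _ a) :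
    traceDim 𝕜 A = 2 * m - 1 := by
  choose c hcj using fun d => (hjθ _).2 (hc d)
  have memx : ∀ i, ∃ s, j s = GWA.x _ a ^ (m * i) := fun i => (hjθ _).2 (by
    rw [map_pow, hx, _root_.smul_pow, pow_mul ω, hω.pow_eq_one, one_pow, one_smul])
  have memy : ∀ i, ∃ s, j s = GWA.y _ a ^ (m * i) := fun i => (hjθ _).2 (by
    rw [map_pow, hy, _root_.smul_pow, pow_mul ω⁻¹, hω.inv.pow_eq_one, one_pow, one_smul])
  let C : Submodule 𝕜 A := commutatorSpan 𝕜 A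
  let ι : 𝕜[X] →ₗ[𝕜] A :=
    { toFun := c
      map_add' := fun d e => hj (by rw [map_add, hcj, hcj, hcj, map_add])
      map_smul' := fun k d => hj (by rw [RingHom.id_apply, map_smul, hcj, hcj, map_smul]) }
  have hι : ∀ d, j (ι d) = GWA.coeff _ a d := hcj
  have hspan : ∀ s, j s ∈ Submodule.span 𝕜 (monomialsOfDvd α a m) := fun s =>
    fixed_mem_span hω hm hc hx hy ((hjθ _).1 ⟨s, rfl⟩)
  -- The trace space is the image of `𝕜[z]`, with kernel exactly the trace relations: the projection
  -- to degree zero bounds the kernel from above, explicit commutators from below.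
  let f : 𝕜[X] →ₗ[𝕜] A ⧸ C := C.mkQ ∘ₗ ι
  have hcomm : C ≤ (LinearMap.range (traceRelation α a m)).comap
      (GWA.degreeZero _ a ∘ₗ j.toLinearMap) := by
    refine Submodule.span_le.2 ?_
    rintro _ ⟨u, v, rfl⟩
    change GWA.degreeZero _ a (j (u * v - v * u)) ∈ LinearMap.range (traceRelation α a m)
    rw [map_sub, map_mul, map_mul]
    exact degreeZero_commutator_mem_of_mem_span hm (hspan u) (hspan v)
  have hker : LinearMap.ker f = LinearMap.range (traceRelation α a m) := by
    ext d
    rw [LinearMap.mem_ker]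
    change C.mkQ (ι d) = 0 ↔ _
    rw [Submodule.mkQ_apply, Submodule.Quotient.mk_eq_zero]
    constructor
    · intro h
      have := hcomm h
      change GWA.degreeZero _ a (j (ι d)) ∈ LinearMap.range (traceRelation α a m) at this
      rwa [hι, GWA.degreeZero_coeff] at this
    · rintro ⟨g, rfl⟩
      obtain ⟨u, hu⟩ := memx 1
      obtain ⟨v, hv⟩ := memy 1
      rw [mul_one] at hu hv
      -- The relation attached to `g` is the commutator of `xᵐ` with `g yᵐ`.
      have := commutator_mem_commutatorSpan 𝕜 u (ι g * v)
      convert this using 1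
      refine hj ?_
      rw [map_sub, map_mul, map_mul, map_mul, map_mul, hu, hv, hι, hι]
      rw [← mul_assoc, GWA.x_pow_mul_coeff, mul_assoc, GWA.x_pow_mul_y_pow, mul_assoc,
        GWA.y_pow_mul_x_pow, ← map_mul, ← map_mul, ← map_mul, ← map_sub, traceRelation_apply,
        mul_comm g]
  have hsurj : Function.Surjective f := by
    have hle : Submodule.span 𝕜 (monomialsOfDvd α a m) ≤
        C.map j.toLinearMap ⊔ LinearMap.range (GWA.coeff _ a).toLinearMap := by
      have hmi : ∀ i, 0 < i → ((m * i : ℕ) : 𝕜) * α ≠ 0 := fun i hi =>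
        mul_ne_zero (Nat.cast_ne_zero.2 (mul_pos hm hi).ne') hα
      -- An eigenvector of `[z, ·]` with nonzero eigenvalue is itself a multiple of a commutator;
      -- applied to monomials of nonzero weight.
      have hz : ∀ (w : A) (c : 𝕜), c ≠ 0 → z α a * j w - j w * z α a = c • j w →
          j w ∈ C.map j.toLinearMap := by
        intro w c hc0 h
        refine ⟨w, ?_, rfl⟩
        have := Submodule.smul_mem _ c⁻¹ (commutator_mem_commutatorSpan 𝕜 (ι X) w)
        refine (congrArg (· ∈ C) (hj ?_)).mp this
        rw [map_smul, map_sub, map_mul, map_mul, hι, h, smul_smul, inv_mul_cancel₀ hc0, one_smul]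
      refine Submodule.span_le.2 ?_
      rintro _ (⟨d, i, rfl⟩ | ⟨d, i, rfl⟩)
      · rcases Nat.eq_zero_or_pos i with rfl | hi
        · exact Submodule.mem_sup_right ⟨d, by simp⟩
        · obtain ⟨u, hu⟩ := memx i
          have hw : j (ι d * u) = GWA.coeff _ a d * GWA.x _ a ^ (m * i) := by rw [map_mul, hu, hι]
          rw [← hw]
          refine Submodule.mem_sup_left (hz _ _ (hmi i hi) ?_)
          rw [hw]
          rw [z, mul_assoc _ _ (GWA.coeff _ a X), GWA.x_pow_mul_coeff, ← mul_assoc, ← mul_assoc,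
            ← map_mul, ← map_mul, ← sub_mul, ← map_sub, ← smul_mul_assoc, ← map_smul,
            shift_pow_apply, X_comp, smul_eq_C_mul, C_neg]
          congr 2
          ring
      · rcases Nat.eq_zero_or_pos i with rfl | hi
        · exact Submodule.mem_sup_right ⟨d, by simp⟩
        · obtain ⟨u, hu⟩ := memy i
          have hw : j (ι d * u) = GWA.coeff _ a d * GWA.y _ a ^ (m * i) := by rw [map_mul, hu, hι]
          rw [← hw]
          refine Submodule.mem_sup_left (hz _ _ (neg_ne_zero.2 (hmi i hi)) ?_)
          rw [hw]
          rw [z, mul_assoc _ _ (GWA.coeff _ a X), GWA.y_pow_mul_coeff, ← mul_assoc, ← mul_assoc,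
            ← map_mul, ← map_mul, ← sub_mul, ← map_sub, ← smul_mul_assoc, ← map_smul,
            shift_inv_pow_X, smul_eq_C_mul, C_neg]
          congr 2
          ring
    intro q
    obtain ⟨r, rfl⟩ := C.mkQ_surjective q
    obtain ⟨_, ⟨s, hs, rfl⟩, _, ⟨d, rfl⟩, hsd⟩ := Submodule.mem_sup.1
      (hle (hspan r))
    refine ⟨d, ?_⟩
    change C.mkQ (ι d) = C.mkQ r
    have hr : r = s + ι d := hj (by rw [map_add, hι]; exact hsd.symm)
    have hs0 : C.mkQ s = 0 := (Submodule.Quotient.mk_eq_zero C).2 hs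
    rw [hr, map_add, hs0, zero_add]
  rw [traceDim, ← (f.quotKerEquivOfSurjective hsurj).finrank_eq, hker,
    finrank_quotient_traceRelation hα ha hm]

end fixed

end ClassicalGWA

/-! ### Orders of diagonal automorphisms and the conclusion -/

namespace ClassicalGWA

variable {𝕜 : Type u} [Field 𝕜] [CharZero 𝕜] {α : 𝕜} {a : 𝕜[X]}

section diag

variable (hα : α ≠ 0) (ha : a.natDegree = 2) (t : 𝕜ˣ)

lemma conj_diag_slE : conj hα ha (diagSL t) (slE α a) = (t : 𝕜) ^ 2 • slE α a := by
  have h00 : diagSL t 0 0 = (t : 𝕜) := rfl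
  have h10 : diagSL t 1 0 = 0 := rfl
  rw [conj_apply, conjHom_slE, h00, h10]
  module

lemma conj_diag_slF : conj hα ha (diagSL t) (slF α a) = ((t : 𝕜) ^ 2)⁻¹ • slF α a := by
  have h01 : diagSL t 0 1 = 0 := rfl
  have h11 : diagSL t 1 1 = (t : 𝕜)⁻¹ := Units.val_inv_eq_inv_val t
  rw [conj_apply, conjHom_slF, h01, h11, inv_pow]
  module

lemma conj_diag_slH : conj hα ha (diagSL t) (slH α a) = slH α a := by
  have h00 : diagSL t 0 0 = (t : 𝕜) := rfl
  have h10 : diagSL t 1 0 = 0 := rfl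
  have h01 : diagSL t 0 1 = 0 := rfl
  have h11 : diagSL t 1 1 = (t : 𝕜)⁻¹ := Units.val_inv_eq_inv_val t
  rw [conj_apply, conjHom_slH, h00, h10, h01, h11, mul_inv_cancel₀ t.ne_zero]
  module

lemma conj_diag_x :
    conj hα ha (diagSL t) (GWA.x _ a) = (t : 𝕜) ^ 2 • GWA.x _ a := conj_diag_slE hα ha t

lemma conj_diag_y :
    conj hα ha (diagSL t) (GWA.y _ a) = ((t : 𝕜) ^ 2)⁻¹ • GWA.y _ a := by
  have h := conj_diag_slF hα ha t
  have h2 : -(α ^ 2 * a.coeff 2)⁻¹ ≠ 0 :=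
    neg_ne_zero.2 (inv_ne_zero (mul_ne_zero (pow_ne_zero 2 hα) (coeff_two_ne_zero ha)))
  rw [slF, map_smul, smul_comm] at h
  exact smul_right_injective _ h2 h

lemma conj_diag_coeff (d : 𝕜[X]) :
    conj hα ha (diagSL t) (GWA.coeff _ a d) = GWA.coeff _ a d := by
  have h := conj_diag_slH hα ha t
  rw [slH, map_smul] at h
  have h' := smul_right_injective _ (inv_ne_zero hα) h
  rw [map_add, AlgEquiv.commutes, add_left_inj] at h'
  rw [coeff_eq_aeval, ← aeval_algHom_apply, h']

/-- The eigenvalues on `E, F, H` are `t²`, `t⁻²` and `1`. The root is `t²` rather than `t` because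
`-1` acts trivially. -/
lemma isPrimitiveRoot_orderOf_conj_diag :
    IsPrimitiveRoot ((t : 𝕜) ^ 2) (orderOf (conj hα ha (diagSL t))) := by
  have hpow : ∀ {η : 𝕜} {w : ClassicalGWA α a}, conj hα ha (diagSL t) w = η • w →
      ∀ l : ℕ, (conj hα ha (diagSL t) ^ l) w = η ^ l • w := by
    intro η w hw l
    induction l with
    | zero => simp
    | succ l ih => rw [pow_succ', AlgEquiv.mul_apply, ih, map_smul, hw, smul_smul, pow_succ]
  have h2 := coeff_two_ne_zero ha
  have key : ∀ l : ℕ, ((t : 𝕜) ^ 2) ^ l = 1 ↔ conj hα ha (diagSL t) ^ l = 1 := by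
    intro l
    have hE := hpow (conj_diag_slE hα ha t) l
    constructor
    · intro h
      have hF := hpow (conj_diag_slF hα ha t) l
      have hH := hpow (η := 1) ((conj_diag_slH hα ha t).trans (one_smul _ _).symm) l
      rw [h, one_smul] at hE
      rw [inv_pow, h, inv_one, one_smul] at hF
      rw [one_pow, one_smul] at hH
      have : (conj hα ha (diagSL t) ^ l).toAlgHom = AlgHom.id 𝕜 _ :=
        algHom_ext_sl hα h2 hE hF hH
      exact AlgEquiv.ext fun r => DFunLike.congr_fun this r
    · intro h
      rw [h, AlgEquiv.one_apply] at hE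
      have := sl_ext (c := 0) (u := 1) (v := 0) (w := 0) (c' := 0) (u' := ((t : 𝕜) ^ 2) ^ l)
        (v' := 0) (w' := 0) hα h2 (by rw [← hE]; simp)
      exact this.2.1.symm
  exact ⟨(key _).2 (pow_orderOf_eq_one _), fun l hl => orderOf_dvd_of_pow_eq_one ((key l).1 hl)⟩

end diag

/-- The trace space of the fixed ring of a filtered automorphism of finite order. -/
theorem traceDim_fixedRing_zpowers [IsAlgClosed 𝕜] (hα : α ≠ 0) (ha : a.natDegree = 2)
    {φ : ClassicalGWA α a ≃ₐ[𝕜] ClassicalGWA α a}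
    (hφ : φ ∈ filteredAut α a) (hfin : IsOfFinOrder φ) :
    traceDim 𝕜 (fixedRing (Subgroup.zpowers φ)) = 2 * orderOf φ - 1 := by
  obtain ⟨g, rfl⟩ := exists_conj_eq hα ha hφ
  obtain ⟨P, t, hP⟩ := exists_diag_of_isOfFinOrder hα ha hfin
  set ψ := conj hα ha P
  set θ := conj hα ha (diagSL t)
  have hord : orderOf (conj hα ha g) = orderOf θ := by
    rw [hP, ← MulAut.conj_apply]
    exact orderOf_injective (MulAut.conj ψ).toMonoidHom (MulAut.conj ψ).injective θ
  have happ : ∀ r, conj hα ha g (ψ r) = ψ (θ r) := fun r => by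
    rw [hP, AlgEquiv.mul_apply, AlgEquiv.mul_apply]
    exact congrArg (fun s => ψ (θ s)) (ψ.symm_apply_apply r)
  have hfin' := hfin.orderOf_pos
  rw [hord] at hfin' ⊢
  -- The fixed ring of `ψ θ ψ⁻¹` is embedded in `R` through `ψ⁻¹`, with image the fixed ring of `θ`.
  refine traceDim_of_fixed_diag (θ := θ)
    (ψ.symm.toAlgHom.comp (fixedRing (Subgroup.zpowers (conj hα ha g))).val)
    (ψ.symm.injective.comp Subtype.val_injective) (fun r => ?_) hα ha
    (isPrimitiveRoot_orderOf_conj_diag hα ha t) hfin' (conj_diag_coeff hα ha t)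
    (conj_diag_x hα ha t) (conj_diag_y hα ha t)
  constructor
  · rintro ⟨s, rfl⟩
    refine ψ.injective ?_
    rw [← happ]
    have hs := mem_fixedRing_zpowers.1 s.2
    have : ψ (ψ.symm s.1) = s.1 := ψ.apply_symm_apply _
    change conj hα ha g (ψ (ψ.symm s.1)) = ψ (ψ.symm s.1)
    rw [this, hs]
  · intro h
    exact ⟨⟨ψ r, mem_fixedRing_zpowers.2 (by rw [happ, h])⟩, ψ.symm_apply_apply r⟩

theorem traceDim_fixedRing [IsAlgClosed 𝕜] (hα : α ≠ 0) (ha : a.natDegree = 2)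
    (G : Subgroup (ClassicalGWA α a ≃ₐ[𝕜] ClassicalGWA α a)) (hG : G ≤ filteredAut α a)
    [Finite G] [hc : IsCyclic G] : traceDim 𝕜 (fixedRing G) = 2 * Nat.card G - 1 := by
  obtain ⟨φ, rfl⟩ := (Subgroup.isCyclic_iff_exists_zpowers_eq_top G).1 hc
  rw [Nat.card_zpowers]
  refine traceDim_fixedRing_zpowers hα ha (hG (Subgroup.mem_zpowers φ)) ?_
  exact finite_zpowers.1 (Set.toFinite _)

theorem nonempty_mulEquiv_of_fixedRing [IsAlgClosed 𝕜] (hα : α ≠ 0) (ha : a.natDegree = 2)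
    {G H : Subgroup (ClassicalGWA α a ≃ₐ[𝕜] ClassicalGWA α a)} (hG : G ≤ filteredAut α a)
    (hH : H ≤ filteredAut α a) [Finite G] [IsCyclic G] [Finite H] [IsCyclic H]
    (e : fixedRing G ≃ₐ[𝕜] fixedRing H) : Nonempty (G ≃* H) := by
  have h := traceDim_congr (A := fixedRing G) (B := fixedRing H) e
  rw [traceDim_fixedRing hα ha G hG, traceDim_fixedRing hα ha H hH] at h
  have h1 := Nat.card_pos (α := G)
  have h2 := Nat.card_pos (α := H)
  exact ⟨mulEquivOfCyclicCardEq (by omega)⟩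

end ClassicalGWA

theorem mainTheorem5 {𝕜 : Type u} [Field 𝕜] [IsAlgClosed 𝕜] [CharZero 𝕜]
    (α : 𝕜) (hα : α ≠ 0) (a : 𝕜[X]) (ha : a.natDegree = 2) :
    (∀ G H : Subgroup (ClassicalGWA α a ≃ₐ[𝕜] ClassicalGWA α a),
      G ≤ ClassicalGWA.filteredAut α a → H ≤ ClassicalGWA.filteredAut α a →
      Finite G → IsCyclic G → Finite H → IsCyclic H →
      Nonempty (fixedRing G ≃ₐ[𝕜] fixedRing H) → Nonempty (G ≃* H)) ∧
    (∀ H : Subgroup (ClassicalGWA α a ≃ₐ[𝕜] ClassicalGWA α a),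
      H ≤ ClassicalGWA.filteredAut α a → Finite H → IsCyclic H →
      Nonempty (fixedRing H ≃ₐ[𝕜] ClassicalGWA α a) → H = ⊥) := by
  constructor
  · rintro G H hG hH _ _ _ _ ⟨e⟩
    exact ClassicalGWA.nonempty_mulEquiv_of_fixedRing hα ha hG hH e
  · rintro H hH _ _ ⟨e⟩
    have h := traceDim_congr (A := fixedRing H) (B := ClassicalGWA α a) e
    -- The algebra `R` is the fixed ring of the trivial group, so the same formula applies to it
    -- with order `1`.
    have htriv : traceDim 𝕜 (fixedRing (⊥ : Subgroup (ClassicalGWA α a ≃ₐ[𝕜] ClassicalGWA α a))) =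
        traceDim 𝕜 (ClassicalGWA α a) := by
      refine traceDim_congr (AlgEquiv.ofBijective (Subalgebra.val _)
        ⟨Subtype.val_injective, fun r => ⟨⟨r, ?_⟩, rfl⟩⟩)
      rintro ⟨g, hg⟩
      rw [Subgroup.mem_bot] at hg
      subst hg
      rfl
    rw [← htriv, ClassicalGWA.traceDim_fixedRing hα ha H hH,
      ClassicalGWA.traceDim_fixedRing hα ha ⊥ bot_le, Subgroup.card_bot] at h
    have h1 := Nat.card_pos (α := H)
    exact Subgroup.card_eq_one.1 (by omega)
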